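/- **Invariants of $k$-vectors.** Let $\mathbb F$ be a field of characteristic $0$, $V$ a finite-dimensional $\mathbb F$-vector space, $k\ge 1$ and $0\neq X\in\Lambda^kV$. * The length $l(X)$ is the smallest $l\in\mathbb N_0$ such that $X$ is a sum of $l$ decomposable $k$-vectors $v_1\wedge\dots\wedge v_k$. * The support $[X]$ is the intersection of all subspaces $U\subseteq V$ with $X\in\Lambda^kU$; the rank is $\rho(X)=\dim[X]$. * For $0\ne v\in[X]$ and a complement $U$ of $\operatorname{span}(v)$ in $[X]$ write uniquely $X=X_1\wedge v+X_2$ with $X_1\in\Lambda^{k-1}U$, $X_2\in\Lambda^kU$. Then $m(X)$ is the minimum of $l(X_1)$ and $r(X)$ is the minimum of $l(X_2)$ over all choices of $v$ and $U$. **Structures.** Let $V$ be a seven-dimensional real and $W$ a seven-dimensional complex vector space. For a basis $e_1,\dots,e_7$ with dual basis $e^1,\dots,e^7$ write $e^{ijk}=e^i\wedge e^j\wedge e^k$, etc. * A $G_2$-structure on $V$ is a three-form $\varphi\in\Lambda^3V^*$ such that $\varphi=e^{127}+e^{347}+e^{567}+e^{135}-e^{146}-e^{236}-e^{245}$ for some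 basis of $V$. * A $G_2^*$-structure on $V$ is a three-form $\tilde\varphi\in\Lambda^3V^*$ such that $\tilde\varphi=-e^{127}-e^{347}+e^{567}+e^{135}-e^{146}-e^{236}-e^{245}$ for some basis of $V$. * A $(G_2)_{\mathbb C}$-structure on $W$ is a pair $(\varphi_{\mathbb C},\mathrm{vol}_{\mathbb C})\in\Lambda^3W^*\times\Lambda^7W^*$ such that, for some complex basis of $W$, $\varphi_{\mathbb C}=e^{127}+e^{347}+e^{567}+e^{135}-e^{146}-e^{236}-e^{245}$ and $\mathrm{vol}_{\mathbb C}=e^{1234567}$. Bases as above are called adapted. A $G_2$- or $G_2^*$-structure $\varphi$ induces a unique (pseudo-)Euclidean metric $g$ and a unique volume form $\mathrm{vol}$ such that $g(v,w)\,\mathrm{vol}=\tfrac16(v\lrcorner\varphi)\wedge(w\lrcorner\varphi)\wedge\varphi$ for all $v,w$ and every adapted basis is an oriented orthonormal basis. A $(G_2)_{\mathbb C}$-structure induces a unique complex bilinear form $g_{\mathbb C}$ by the same formula, with $\varphi_{\mathbb C}$ and the given $\mathrm{vol}_{\mathbb C}$. In each case the Hodge dual $\star_\varphi\varphi$ is the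 unique four-form with $\varphi\wedge\chi=g(\star_\varphi\varphi,\chi)\,\mathrm{vol}$ for all four-forms $\chi$ (with $g_{\mathbb C},\mathrm{vol}_{\mathbb C}$ in the complex case), where $g$ also denotes the induced bilinear form on four-forms. **Proposition.** Let $\varphi$ be a $G_2$-structure on $V$, let $\tilde\varphi$ be a $G_2^*$-structure on $V$, and let $(\varphi_{\mathbb C},\mathrm{vol}_{\mathbb C})$ be a $(G_2)_{\mathbb C}$-structure on $W$. Then $$(\rho,l,m,r)(\star_\varphi\varphi)=(7,5,3,3),\qquad (\rho,l,m,r)(\star_{\tilde\varphi}\tilde\varphi)=(7,4,2,2),\qquad (\rho,l,m,r)(\star_{\varphi_{\mathbb C}}\varphi_{\mathbb C})=(7,4,2,2).$$ -/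

import Mathlib

namespace G2Inv

open Module

noncomputable section

/-! ### Invariants of `k`-vectors -/

section Invariants

variable {F V : Type*} [Field F] [AddCommGroup V] [Module F V]

/-- A `k`-vector is decomposable if it is of the form `v₁ ∧ ⋯ ∧ v_k`. -/
def IsDecomposable {k : ℕ} (X : ⋀[F]^k V) : Prop :=
  ∃ v : Fin k → V, X = exteriorPower.ιMulti F k v

/-- The (irreducible) length: the least number of decomposable `k`-vectors with sum `X`. -/
def length {k : ℕ} (X : ⋀[F]^k V) : ℕ :=
  sInf {l : ℕ | ∃ Y : Fin l → ⋀[F]^k V, (∀ i, IsDecomposable (Y i)) ∧ X = ∑ i, Y i}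

/-- `Λ^k U`, seen as a subspace of `Λ^k V`, for a subspace `U` of `V`. -/
def subPower (k : ℕ) (U : Submodule F V) : Submodule F (⋀[F]^k V) :=
  LinearMap.range (exteriorPower.map k U.subtype)

/-- The support `[X]`: the intersection of all subspaces `U` of `V` with `X ∈ Λ^k U`. -/
def support {k : ℕ} (X : ⋀[F]^k V) : Submodule F V :=
  sInf {U : Submodule F V | X ∈ subPower k U}

/-- The rank `ρ(X)`: the dimension of the support. -/
def rank {k : ℕ} (X : ⋀[F]^k V) : ℕ := finrank F (support X)

/-- `X = X₁ ∧ v + X₂` with `X₁ ∈ Λ^k U`, `X₂ ∈ Λ^{k+1} U`, where `v` is a non-zero vector of the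
support `[X]` and `U` is a complement of the line spanned by `v` in `[X]`. -/
structure IsSplitting {k : ℕ} (X : ⋀[F]^(k + 1) V) (v : V) (U : Submodule F V)
    (X₁ : ⋀[F]^k V) (X₂ : ⋀[F]^(k + 1) V) : Prop where
  mem_support : v ∈ support X
  ne_zero : v ≠ 0
  inf_eq : Submodule.span F {v} ⊓ U = ⊥
  sup_eq : Submodule.span F {v} ⊔ U = support X
  left_mem : X₁ ∈ subPower k U
  right_mem : X₂ ∈ subPower (k + 1) U
  eq_add : (X : ExteriorAlgebra F V) =
    (X₁ : ExteriorAlgebra F V) * ExteriorAlgebra.ι F v + (X₂ : ExteriorAlgebra F V)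

/-- `D(X)`: the set of all components `X₁` in the splittings `X = X₁ ∧ v + X₂`. -/
def setD {k : ℕ} (X : ⋀[F]^(k + 1) V) : Set (⋀[F]^k V) :=
  {X₁ | ∃ v U X₂, IsSplitting X v U X₁ X₂}

/-- `E(X)`: the set of all components `X₂` in the splittings `X = X₁ ∧ v + X₂`. -/
def setE {k : ℕ} (X : ⋀[F]^(k + 1) V) : Set (⋀[F]^(k + 1) V) :=
  {X₂ | ∃ v U X₁, IsSplitting X v U X₁ X₂}

/-- `m(X)`: the minimal length of an element of `D(X)`. -/
def invM {k : ℕ} (X : ⋀[F]^(k + 1) V) : ℕ := sInf (length '' setD X)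

/-- `r(X)`: the minimal length of an element of `E(X)`. -/
def invR {k : ℕ} (X : ⋀[F]^(k + 1) V) : ℕ := sInf (length '' setE X)

end Invariants

/-! ### Exterior forms and the Hodge star operator -/

section Forms

variable {F V : Type*} [Field F] [AddCommGroup V] [Module F V]

/-- `k`-forms on `V`, i.e. elements of `Λ^k V*`. -/
abbrev Form (F V : Type*) [Field F] [AddCommGroup V] [Module F V] (k : ℕ) : Type _ :=
  ⋀[F]^k (Dual F V)

/-- The contraction `v ⌟ ψ` of a form with a vector. -/
def contract {k : ℕ} (v : V) (ψ : Form F V k) : ExteriorAlgebra F (Dual F V) :=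
  CliffordAlgebra.contractLeft (Dual.eval F V v) (ψ : ExteriorAlgebra F (Dual F V))

/-- `e^{ijk} = e^i ∧ e^j ∧ e^k` for the dual basis of `e`, with indices in `{1,…,7}`. -/
def e3 (e : Basis (Fin 7) F V) (i j k : ℕ) (hi : i - 1 < 7 := by decide)
    (hj : j - 1 < 7 := by decide) (hk : k - 1 < 7 := by decide) : Form F V 3 :=
  exteriorPower.ιMulti F 3 ![e.coord ⟨i - 1, hi⟩, e.coord ⟨j - 1, hj⟩, e.coord ⟨k - 1, hk⟩]

/-- `e^{1234567}` for the dual basis of `e`. -/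
def e7 (e : Basis (Fin 7) F V) : Form F V 7 :=
  exteriorPower.ιMulti F 7 e.coord

/-- `e^{127} + e^{347} + e^{567} + e^{135} - e^{146} - e^{236} - e^{245}`. -/
def g2Form (e : Basis (Fin 7) F V) : Form F V 3 :=
  e3 e 1 2 7 + e3 e 3 4 7 + e3 e 5 6 7 + e3 e 1 3 5 - e3 e 1 4 6 - e3 e 2 3 6 - e3 e 2 4 5

/-- `-e^{127} - e^{347} + e^{567} + e^{135} - e^{146} - e^{236} - e^{245}`. -/
def g2StarForm (e : Basis (Fin 7) F V) : Form F V 3 :=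
  - e3 e 1 2 7 - e3 e 3 4 7 + e3 e 5 6 7 + e3 e 1 3 5 - e3 e 1 4 6 - e3 e 2 3 6 - e3 e 2 4 5

/-- `g(v,w) vol = (1/6) (v ⌟ φ) ∧ (w ⌟ φ) ∧ φ` for all `v, w`. -/
def MetricFormula (φ : Form F V 3) (g : LinearMap.BilinForm F V) (vol : Form F V 7) : Prop :=
  ∀ v w : V, g v w • (vol : ExteriorAlgebra F (Dual F V)) =
    (1 / 6 : F) • (contract v φ * contract w φ * (φ : ExteriorAlgebra F (Dual F V)))

/-- The isomorphism `V* → V` induced by a non-degenerate symmetric bilinear form `g`, inverse to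
`v ↦ g(v, ·)` (and zero if `g` is degenerate). -/
def sharp [FiniteDimensional F V] (g : LinearMap.BilinForm F V) : Dual F V →ₗ[F] V :=
  open Classical in
  if h : g.Nondegenerate then ((g.toDual h).symm : Dual F V →ₗ[F] V) else 0

/-- The bilinear form induced by `g` on `k`-forms:
`g(α₁ ∧ ⋯ ∧ α_k, β₁ ∧ ⋯ ∧ β_k) = det (α_i (♯β_j))`. -/
def formInner [FiniteDimensional F V] (g : LinearMap.BilinForm F V) {k : ℕ}
    (ψ χ : Form F V k) : F :=
  exteriorPower.pairingDual F V k ψ (exteriorPower.map k (sharp g) χ)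

/-- `Ψ` is the Hodge dual of `ψ`: `ψ ∧ χ = g(Ψ, χ) vol` for all `χ` of the same degree as `Ψ`. -/
def IsHodgeDual [FiniteDimensional F V] (g : LinearMap.BilinForm F V) {n k l : ℕ}
    (vol : Form F V n) (ψ : Form F V k) (Ψ : Form F V l) : Prop :=
  ∀ χ : Form F V l, (ψ : ExteriorAlgebra F (Dual F V)) * (χ : ExteriorAlgebra F (Dual F V)) =
    formInner g Ψ χ • (vol : ExteriorAlgebra F (Dual F V))

/-- The Hodge star operator from `k`-forms to `l`-forms, of interest if `k + l = n = dim V`, `g` is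
non-degenerate and `vol ≠ 0`; then there is exactly one Hodge dual. -/
def hodgeStar [FiniteDimensional F V] (g : LinearMap.BilinForm F V) {n k l : ℕ}
    (vol : Form F V n) (ψ : Form F V k) : Form F V l :=
  open Classical in
  if h : ∃ Ψ : Form F V l, IsHodgeDual g vol ψ Ψ then h.choose else 0


theorem contractLeft_mem {M : Type*} [AddCommGroup M] [Module F M] (d : Dual F M) (k : ℕ)
    (x : ExteriorAlgebra F M) (hx : x ∈ ⋀[F]^(k + 1) M) :
    (CliffordAlgebra.contractLeft d x : ExteriorAlgebra F M) ∈ ⋀[F]^k M := by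
  rw [← ExteriorAlgebra.ιMulti_span_fixedDegree] at hx
  induction hx using Submodule.span_induction with
  | zero => simp
  | add x y _ _ hx hy => rw [map_add]; exact add_mem hx hy
  | smul c x _ hx => rw [map_smul]; exact Submodule.smul_mem _ _ hx
  | mem x hx =>
    obtain ⟨v, rfl⟩ := hx
    induction k with
    | zero =>
      rw [ExteriorAlgebra.ιMulti_succ_apply, ExteriorAlgebra.ιMulti_zero_apply]
      erw [CliffordAlgebra.contractLeft_ι_mul, CliffordAlgebra.contractLeft_one]
      simp only [mul_zero, sub_zero]
      refine Submodule.smul_mem _ _ ?_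
      change _ ∈ (LinearMap.range (ExteriorAlgebra.ι F : M →ₗ[F] _)) ^ 0
      rw [pow_zero]
      exact Submodule.one_le.mp le_rfl
    | succ k ih =>
      rw [ExteriorAlgebra.ιMulti_succ_apply]
      erw [CliffordAlgebra.contractLeft_ι_mul]
      refine sub_mem (Submodule.smul_mem _ _ (ExteriorAlgebra.ιMulti_range F _ ⟨_, rfl⟩)) ?_
      change _ ∈ (LinearMap.range (ExteriorAlgebra.ι F : M →ₗ[F] _)) ^ (k + 1)
      rw [pow_succ']
      exact Submodule.mul_mem_mul ⟨_, rfl⟩ (ih _)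

theorem exists_smul_eq [FiniteDimensional F V] {n : ℕ} (hn : finrank F V = n)
    {vol : Form F V n} (hvol : vol ≠ 0) (x : ExteriorAlgebra F (Dual F V))
    (hx : x ∈ ⋀[F]^n (Dual F V)) :
    ∃ c : F, c • (vol : ExteriorAlgebra F (Dual F V)) = x := by
  have h1 : finrank F (Form F V n) = 1 := by
    rw [exteriorPower.finrank_eq, Subspace.dual_finrank_eq, hn, Nat.choose_self]
  obtain ⟨c, hc⟩ := (finrank_eq_one_iff_of_nonzero' vol hvol).1 h1 ⟨x, hx⟩
  exact ⟨c, congrArg Subtype.val hc⟩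

theorem pairingDual_injective [FiniteDimensional F V] (k : ℕ) :
    Function.Injective (exteriorPower.pairingDual F V k) := by
  classical
  let b := finBasis F V
  rw [injective_iff_map_eq_zero]
  intro Ψ h
  have h2 : ∀ s, (b.dualBasis.exteriorPower k).repr Ψ s
      = exteriorPower.pairingDual F V k Ψ (b.exteriorPower k s) := by
    intro s
    have : ((b.dualBasis.exteriorPower k).coord s) =
        (exteriorPower.pairingDual F V k).flip (b.exteriorPower k s) := by
      apply (b.dualBasis.exteriorPower k).ext
      intro t
      rw [Basis.coord_apply, Basis.repr_self]
      have hd : exteriorPower.pairingDual F V k (exteriorPower.ιMulti_family F k b.dualBasis t)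
          = (b.exteriorPower k).coord t := by
        rw [exteriorPower.basis_coord, Basis.coe_dualBasis]
        rfl
      rw [LinearMap.flip_apply, exteriorPower.basis_apply _ _ b.dualBasis, hd, Basis.coord_apply, Basis.repr_self,
        Finsupp.single_apply, Finsupp.single_apply]
      simp [eq_comm]
    exact LinearMap.congr_fun this Ψ
  apply (b.dualBasis.exteriorPower k).repr.injective
  ext s
  rw [h2, h]; simp

/-- The Hodge dual is well defined. -/
theorem existsUnique_isHodgeDual [FiniteDimensional F V] {g : LinearMap.BilinForm F V}
    (hg : g.Nondegenerate) {n k l : ℕ} (hn : finrank F V = n) (hkl : k + l = n)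
    {vol : Form F V n} (hvol : vol ≠ 0) (ψ : Form F V k) :
    ∃! Ψ : Form F V l, IsHodgeDual g vol ψ Ψ := by
  have hv : (vol : ExteriorAlgebra F (Dual F V)) ≠ 0 := by simpa using hvol
  have hs : Function.Surjective (exteriorPower.map l (sharp g)) := by
    apply exteriorPower.map_surjective
    rw [sharp, dif_pos hg]
    exact (g.toDual hg).symm.surjective
  let T : Form F V l →ₗ[F] Dual F (Form F V l) :=
    (exteriorPower.pairingDual F V l).compl₂ (exteriorPower.map l (sharp g))
  have hT : Function.Injective T := by
    rw [injective_iff_map_eq_zero]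
    intro Ψ h
    apply pairingDual_injective l
    refine LinearMap.ext fun y => ?_
    obtain ⟨χ, rfl⟩ := hs y
    rw [map_zero]
    exact LinearMap.congr_fun h χ
  have hT' : Function.Surjective T :=
    (LinearMap.injective_iff_surjective_of_finrank_eq_finrank
      (Subspace.dual_finrank_eq).symm).1 hT
  have hc : ∀ χ : Form F V l, ∃ c : F, c • (vol : ExteriorAlgebra F (Dual F V)) =
      (ψ : ExteriorAlgebra F (Dual F V)) * (χ : ExteriorAlgebra F (Dual F V)) := by
    intro χ
    apply exists_smul_eq hn hvol
    subst hkl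
    change _ ∈ (LinearMap.range (ExteriorAlgebra.ι F : Dual F V →ₗ[F] _)) ^ (k + l)
    rw [pow_add]
    exact Submodule.mul_mem_mul ψ.2 χ.2
  choose c hc using hc
  let L : Dual F (Form F V l) :=
    { toFun := c
      map_add' := fun x y => smul_left_injective F hv (by
        simp only [hc, add_smul, Submodule.coe_add, mul_add])
      map_smul' := fun a x => smul_left_injective F hv (by
        simp [hc, mul_smul]) }
  obtain ⟨Ψ, hΨ⟩ := hT' L
  refine ⟨Ψ, fun χ => ?_, fun Ψ' h' => hT ?_⟩
  · rw [← hc]; exact congrArg (· • _) (LinearMap.congr_fun hΨ χ).symm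
  · rw [hΨ]
    refine LinearMap.ext fun χ => ?_
    exact smul_left_injective F hv ((h' χ).symm.trans (hc χ).symm)

/-- The metric formula determines a unique bilinear form once the volume form is given. -/
theorem existsUnique_metricFormula [FiniteDimensional F V] (hn : finrank F V = 7)
    {vol : Form F V 7} (hvol : vol ≠ 0) (φ : Form F V 3) :
    ∃! g : LinearMap.BilinForm F V, MetricFormula φ g vol := by
  have hv : (vol : ExteriorAlgebra F (Dual F V)) ≠ 0 := by simpa using hvol
  have hc : ∀ v w : V, ∃ c : F, c • (vol : ExteriorAlgebra F (Dual F V)) =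
      (1 / 6 : F) • (contract v φ * contract w φ * (φ : ExteriorAlgebra F (Dual F V))) := by
    intro v w
    apply exists_smul_eq hn hvol
    apply Submodule.smul_mem
    change _ ∈ (LinearMap.range (ExteriorAlgebra.ι F : Dual F V →ₗ[F] _)) ^ (2 + 2 + 3)
    rw [pow_add, pow_add]
    exact Submodule.mul_mem_mul (Submodule.mul_mem_mul (contractLeft_mem _ _ _ φ.2)
      (contractLeft_mem _ _ _ φ.2)) φ.2
  choose c hc using hc
  have ha : ∀ v v' : V, contract (v + v') φ = contract v φ + contract v' φ := by
    intro v v'; simp [contract]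
  have hm : ∀ (a : F) (v : V), contract (a • v) φ = a • contract v φ := by
    intro a v; simp [contract]
  refine ⟨LinearMap.mk₂ F c ?_ ?_ ?_ ?_, fun v w => hc v w, fun g' h' => ?_⟩
  · intro x y z; apply smul_left_injective F hv
    simp only [hc, add_smul, ha, add_mul, smul_add]
  · intro a x z; apply smul_left_injective F hv
    simp only [hc, smul_assoc, hm, smul_mul_assoc, smul_comm a (1/6 : F)]
  · intro x y z; apply smul_left_injective F hv
    simp only [hc, add_smul, ha, add_mul, mul_add, smul_add]
  · intro a x z; apply smul_left_injective F hv
    simp only [hc, smul_assoc, hm, smul_mul_assoc, mul_smul_comm, smul_comm a (1/6 : F)]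
  · ext v w
    exact smul_left_injective F hv ((h' v w).trans (hc v w).symm)

end Forms

/-! ### `G₂`- and `G₂*`-structures on real vector spaces -/

section Real

variable {V : Type*} [AddCommGroup V] [Module ℝ V]

def IsG2Structure (φ : Form ℝ V 3) : Prop :=
  ∃ e : Basis (Fin 7) ℝ V, φ = g2Form e

def IsG2StarStructure (φ : Form ℝ V 3) : Prop :=
  ∃ e : Basis (Fin 7) ℝ V, φ = g2StarForm e

/-- `e` is an adapted basis for the `G₂`- or `G₂*`-structure `φ`. -/
def IsAdapted (φ : Form ℝ V 3) (e : Basis (Fin 7) ℝ V) : Prop :=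
  φ = g2Form e ∨ φ = g2StarForm e

/-- `(g, vol)` are the (pseudo-)Euclidean metric and the metric volume form induced by a `G₂`- or
`G₂*`-structure `φ`: they satisfy `g(v,w) vol = (1/6) (v ⌟ φ) ∧ (w ⌟ φ) ∧ φ`, and each adapted
basis is an oriented orthonormal basis. -/
structure IsInducedMetric (φ : Form ℝ V 3) (g : LinearMap.BilinForm ℝ V) (vol : Form ℝ V 7) :
    Prop where
  formula : MetricFormula φ g vol
  orthogonal : ∀ e, IsAdapted φ e → ∀ i j, i ≠ j → g (e i) (e j) = 0
  normalized : ∀ e, IsAdapted φ e → ∀ i, g (e i) (e i) = 1 ∨ g (e i) (e i) = -1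
  oriented : ∀ e, IsAdapted φ e → vol = e7 e

/-- The metric and the volume form induced by a `G₂`- or `G₂*`-structure. -/
def inducedMetric (φ : Form ℝ V 3) : LinearMap.BilinForm ℝ V × Form ℝ V 7 :=
  open Classical in
  if h : ∃ p : LinearMap.BilinForm ℝ V × Form ℝ V 7, IsInducedMetric φ p.1 p.2
  then h.choose else 0

/-- The Hodge dual `⋆_φ φ` of a `G₂`- or `G₂*`-structure `φ`. -/
def hodgeDual [FiniteDimensional ℝ V] (φ : Form ℝ V 3) : Form ℝ V 4 :=
  hodgeStar (inducedMetric φ).1 (inducedMetric φ).2 φ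

end Real

/-! ### `(G₂)_ℂ`-structures on complex vector spaces -/

section Complex

variable {W : Type*} [AddCommGroup W] [Module ℂ W]

def IsG2CStructure (φ : Form ℂ W 3) (vol : Form ℂ W 7) : Prop :=
  ∃ e : Basis (Fin 7) ℂ W, φ = g2Form e ∧ vol = e7 e

/-- The complex bilinear form induced by a `(G₂)_ℂ`-structure. -/
def inducedMetricC (φ : Form ℂ W 3) (vol : Form ℂ W 7) : LinearMap.BilinForm ℂ W :=
  open Classical in
  if h : ∃ g : LinearMap.BilinForm ℂ W, MetricFormula φ g vol then h.choose else 0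

/-- The Hodge dual `⋆_φ φ` of a `(G₂)_ℂ`-structure `(φ, vol)`. -/
def hodgeDualC [FiniteDimensional ℂ W] (φ : Form ℂ W 3) (vol : Form ℂ W 7) : Form ℂ W 4 :=
  hodgeStar (inducedMetricC φ vol) vol φ

end Complex

end

end G2Inv

namespace G2Inv

open Module ExteriorAlgebra

/-! ### Annihilators of decomposable vectors under the wedge product -/

section Annihilators

variable {F E : Type*} [Field F] [AddCommGroup E] [Module F E]

/-! Everything rests on how large a space of `w` with `w ∧ v ∧ X = 0` can be for fixed `v ≠ 0`. For
the dual four-form `X`, wedging `w ∧ v ∧ X` with basis vectors yields the components of a cross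
product of `w` and `v`. The double cross product identity turns its vanishing into `⟨v, v⟩ w = ⟨v,
w⟩ v`. If `v` is not null, `w` lies on the line of `v`. If `v` is null, the admissible `w` form a
totally isotropic subspace, of dimension at most 3 in dimension 7. Hence `SmallAnnihilators X 1` in
the definite real case and `SmallAnnihilators X 4` in general.

All lower bounds are dimension counts against this. A decomposable four-vector `C` is annihilated by
a 4-dimensional space and `v ∧ C` by a 5-dimensional one, so `v ∧ X` cannot equal `v ∧ C` (bound 4),
nor `v ∧ C + v ∧ D` (bound 1, as `5 + 5 - 7 = 3`). For the length, `v` is a common factor of two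
summands. For `r`, it is the vector of the splitting, as `v ∧ X = v ∧ X₂`. For `m`, a vector `p` of
`U` annihilating a summand of `X₁` is wedged instead, and `Λ^6 U` being a line makes the annihilator
of `p ∧ X` too large. The upper bounds are explicit decompositions.

It remains to identify the Hodge dual with `fourForm` (`inducedMetric_threeForm`,
`hodgeStar_threeForm`). Over `ℂ`, rescaling the basis reduces the problem to the split form
(`fourForm_one_eq`). -/

theorem ι_mul_ι_swap (v w : E) : ι F v * ι F w = -(ι F w * ι F v) :=
  eq_neg_of_add_eq_zero_left (ι_add_mul_swap v w)

theorem ι_mul_ι_mul_swap (v w : E) (z : ExteriorAlgebra F E) :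
    ι F v * (ι F w * z) = -(ι F w * (ι F v * z)) := by
  rw [← mul_assoc, ι_mul_ι_swap, neg_mul, mul_assoc]

theorem ι_mul_ι_mul_self (v : E) (z : ExteriorAlgebra F E) :
    ι F v * (ι F v * z) = 0 := by
  rw [← mul_assoc, ι_sq_zero, zero_mul]

theorem ι_mul_mul_ι_self (v : E) (y : ExteriorAlgebra F E) : ι F v * (y * ι F v) = 0 := by
  induction y using CliffordAlgebra.left_induction with
  | algebraMap r =>
    change ι F v * (algebraMap F (ExteriorAlgebra F E) r * ι F v) = 0
    rw [Algebra.commutes, ι_mul_ι_mul_self]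
  | add x y hx hy => rw [add_mul, mul_add, hx, hy, add_zero]
  | ι_mul x m hx =>
    change ι F v * (ι F m * x * ι F v) = 0
    rw [mul_assoc, ι_mul_ι_mul_swap, hx, mul_zero, neg_zero]

/-- Independent factors span the required space. Dependent factors make the product zero, so
everything annihilates it; `hk` is needed only there. -/
theorem exists_annihilator_ιMulti [FiniteDimensional F E] {k : ℕ} (hk : k ≤ finrank F E)
    (a : Fin k → E) :
    ∃ P : Submodule F E, k ≤ finrank F P ∧ ∀ p ∈ P, ι F p * ExteriorAlgebra.ιMulti F k a = 0 := by
  by_cases h : LinearIndependent F a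
  · refine ⟨Submodule.span F (Set.range a), ?_, fun p hp => ?_⟩
    · rw [finrank_span_eq_card h, Fintype.card_fin]
    · induction hp using Submodule.span_induction with
      | zero => simp
      | add x y _ _ hx hy => rw [map_add, add_mul, hx, hy, add_zero]
      | smul c x _ hx => rw [map_smul, smul_mul_assoc, hx, smul_zero]
      | mem x hx =>
        obtain ⟨i, rfl⟩ := hx
        have := ExteriorAlgebra.ιMulti_succ_apply (R := F) (Fin.cons (a i) a : Fin (k + 1) → E)
        rw [Fin.cons_zero] at this
        have h2 : Matrix.vecTail (Fin.cons (a i) a : Fin (k + 1) → E) = a := rfl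
        rw [h2] at this
        rw [← this]
        exact AlternatingMap.map_eq_zero_of_eq _ _ (i := 0) (j := i.succ)
          (by simp) (Fin.succ_ne_zero i).symm
  · refine ⟨⊤, by rwa [finrank_top], fun p _ => ?_⟩
    rw [AlternatingMap.map_linearDependent _ _ h, mul_zero]

theorem IsDecomposable.exists_annihilator [FiniteDimensional F E] {k : ℕ}
    (hk : k ≤ finrank F E) {C : ⋀[F]^k E} (hC : IsDecomposable C) :
    ∃ P : Submodule F E, k ≤ finrank F P ∧
      ∀ p ∈ P, ι F p * (C : ExteriorAlgebra F E) = 0 := by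
  obtain ⟨a, rfl⟩ := hC
  exact exists_annihilator_ιMulti hk a

theorem IsDecomposable.exists_annihilator_ι_mul [FiniteDimensional F E] {k : ℕ}
    (hk : k + 1 ≤ finrank F E) {C : ⋀[F]^k E} (hC : IsDecomposable C) (v : E) :
    ∃ P : Submodule F E, k + 1 ≤ finrank F P ∧
      ∀ p ∈ P, ι F p * (ι F v * (C : ExteriorAlgebra F E)) = 0 := by
  obtain ⟨a, rfl⟩ := hC
  obtain ⟨P, hP, h⟩ := exists_annihilator_ιMulti (F := F) hk (Fin.cons v a : Fin (k + 1) → E)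
  refine ⟨P, hP, fun p hp => ?_⟩
  have := h p hp
  rwa [ExteriorAlgebra.ιMulti_succ_apply] at this

theorem exists_ne_zero_of_finrank_pos {P : Submodule F E} (h : 0 < finrank F P) :
    ∃ v ∈ P, v ≠ 0 := by
  by_contra! hc
  rw [(Submodule.eq_bot_iff P).2 hc, finrank_bot] at h
  exact h.ne rfl

/-- Submodules of large dimension intersect. -/
theorem le_finrank_inf [FiniteDimensional F E] {P Q : Submodule F E} {p q n : ℕ}
    (hp : p ≤ finrank F P) (hq : q ≤ finrank F Q) (hn : finrank F E = n) :
    p + q ≤ n + finrank F (P ⊓ Q : Submodule F E) := by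
  have := Submodule.finrank_sup_add_finrank_inf_eq P Q
  have := Submodule.finrank_le (P ⊔ Q)
  omega

/-- Wedging with an element of a subspace `U` of dimension six maps `Λ^5 U` into a line. -/
theorem exists_annihilator_of_mem_subPower [FiniteDimensional F E] {U : Submodule F E}
    (hU : finrank F U = 6) {Z : ⋀[F]^4 E} (hZ : Z ∈ subPower 4 U) {p : E} (hp : p ∈ U)
    (W : Submodule F E) (hW : W ≤ U) :
    ∃ P ≤ W, finrank F W ≤ finrank F P + 1 ∧
      ∀ w ∈ P, ι F w * (ι F p * (Z : ExteriorAlgebra F E)) = 0 := by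
  obtain ⟨Z', rfl⟩ := hZ
  let f : E →ₗ[F] ExteriorAlgebra F E :=
    (LinearMap.mulRight F (ι F p * ((exteriorPower.map 4 U.subtype Z' : ⋀[F]^4 E) :
      ExteriorAlgebra F E))).comp (ι F)
  let g : W →ₗ[F] ExteriorAlgebra F E := f.comp W.subtype
  have hr : LinearMap.range g ≤
      (⋀[F]^6 U).map (ExteriorAlgebra.map U.subtype).toLinearMap := by
    rintro _ ⟨⟨w, hw⟩, rfl⟩
    refine ⟨ι F ⟨w, hW hw⟩ * (ι F ⟨p, hp⟩ * (Z' : ExteriorAlgebra F U)), ?_, ?_⟩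
    · change _ ∈ (LinearMap.range (ExteriorAlgebra.ι F : U →ₗ[F] _)) ^ 6
      rw [pow_succ', pow_succ']
      exact Submodule.mul_mem_mul ⟨_, rfl⟩ (Submodule.mul_mem_mul ⟨_, rfl⟩ Z'.2)
    · have h4 : ExteriorAlgebra.map U.subtype (Z' : ExteriorAlgebra F U) =
          ((exteriorPower.map 4 U.subtype Z' : ⋀[F]^4 E) : ExteriorAlgebra F E) := by
        have hs : Z' ∈ Submodule.span F (Set.range (exteriorPower.ιMulti F 4 (M := U))) := by
          rw [exteriorPower.ιMulti_span]; trivial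
        induction hs using Submodule.span_induction with
        | zero => simp
        | add x y _ _ hx hy => simp only [map_add, Submodule.coe_add, hx, hy]
        | smul c x _ hx => simp only [map_smul, Submodule.coe_smul, hx]
        | mem x hx =>
          obtain ⟨a, rfl⟩ := hx
          rw [exteriorPower.map_apply_ιMulti, exteriorPower.ιMulti_apply_coe,
            exteriorPower.ιMulti_apply_coe, ExteriorAlgebra.map_apply_ιMulti]
      simp [g, f, h4, mul_assoc]
  have h1 : finrank F (LinearMap.range g) ≤ 1 := by
    refine (Submodule.finrank_mono hr).trans ((Submodule.finrank_map_le _ _).trans ?_)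
    rw [exteriorPower.finrank_eq, hU, Nat.choose_self]
  refine ⟨(LinearMap.ker g).map W.subtype, Submodule.map_subtype_le _ _, ?_, ?_⟩
  · rw [Submodule.finrank_map_subtype_eq, ← LinearMap.finrank_range_add_finrank_ker g]
    omega
  · rintro _ ⟨w, hw, rfl⟩
    exact hw

theorem finrank_eq_six_of_isCompl_span {n : ℕ} [FiniteDimensional F E]
    (hE : finrank F E = n + 1) {v : E} (hv : v ≠ 0) {U : Submodule F E}
    (h1 : Submodule.span F {v} ⊓ U = ⊥) (h2 : Submodule.span F {v} ⊔ U = ⊤) :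
    finrank F U = n := by
  have := Submodule.finrank_sup_add_finrank_inf_eq (Submodule.span F {v}) U
  rw [h1, h2, finrank_top, finrank_bot, hE, finrank_span_singleton hv] at this
  omega

end Annihilators

/-! ### Length, `Λ^k U` and splittings -/

section Length

variable {F E : Type*} [Field F] [AddCommGroup E] [Module F E]

theorem isDecomposable_zero {k : ℕ} : IsDecomposable (0 : ⋀[F]^(k + 1) E) :=
  ⟨0, (AlternatingMap.map_zero _).symm⟩

theorem IsDecomposable.smul {k : ℕ} {X : ⋀[F]^(k + 1) E} (hX : IsDecomposable X) (c : F) :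
    IsDecomposable (c • X) := by
  obtain ⟨a, rfl⟩ := hX
  refine ⟨Function.update a 0 (c • a 0), ?_⟩
  rw [AlternatingMap.map_update_smul, Function.update_eq_self]

theorem exists_sum_isDecomposable {k : ℕ} (X : ⋀[F]^(k + 1) E) :
    ∃ (l : ℕ) (Y : Fin l → ⋀[F]^(k + 1) E), (∀ i, IsDecomposable (Y i)) ∧ X = ∑ i, Y i := by
  have hs : X ∈ Submodule.span F (Set.range (exteriorPower.ιMulti F (k + 1) (M := E))) := by
    rw [exteriorPower.ιMulti_span]; trivial
  induction hs using Submodule.span_induction with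
  | zero => exact ⟨0, Fin.elim0, fun i => i.elim0, by simp⟩
  | add x y _ _ hx hy =>
    obtain ⟨l, Y, h, rfl⟩ := hx
    obtain ⟨l', Y', h', rfl⟩ := hy
    refine ⟨l + l', Fin.append Y Y', fun i => ?_, by simp [Fin.sum_univ_add]⟩
    induction i using Fin.addCases <;> simp [h, h']
  | smul c x _ hx =>
    obtain ⟨l, Y, h, rfl⟩ := hx
    exact ⟨l, fun i => c • Y i, fun i => (h i).smul c, Finset.smul_sum⟩
  | mem x hx =>
    obtain ⟨a, rfl⟩ := hx
    exact ⟨1, fun _ => exteriorPower.ιMulti F (k + 1) a, fun _ => ⟨a, rfl⟩, by simp⟩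

/-- A shorter sum is padded with zeros. This requires positive degree: the only decomposable
0-vector is 1. -/
theorem length_le_iff {k n : ℕ} (X : ⋀[F]^(k + 1) E) :
    length X ≤ n ↔
      ∃ Y : Fin n → ⋀[F]^(k + 1) E, (∀ i, IsDecomposable (Y i)) ∧ X = ∑ i, Y i := by
  refine ⟨fun h => ?_, fun h => Nat.sInf_le h⟩
  obtain ⟨Y, hY, hX⟩ : length X ∈ {l : ℕ | ∃ Y : Fin l → ⋀[F]^(k + 1) E,
      (∀ i, IsDecomposable (Y i)) ∧ X = ∑ i, Y i} := Nat.sInf_mem (exists_sum_isDecomposable X)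
  obtain ⟨d, rfl⟩ := Nat.exists_eq_add_of_le h
  refine ⟨Fin.append Y 0, fun i => ?_, by simpa [Fin.sum_univ_add] using hX⟩
  induction i using Fin.addCases
  · simp [hY]
  · simpa using isDecomposable_zero

theorem subPower_mono {k : ℕ} {U U' : Submodule F E} (h : U ≤ U') :
    subPower (F := F) k U ≤ subPower k U' := by
  rintro _ ⟨x, rfl⟩
  refine ⟨exteriorPower.map k (Submodule.inclusion h) x, ?_⟩
  rw [← LinearMap.comp_apply, ← exteriorPower.map_comp]
  rfl

theorem ιMulti_mem_subPower {k : ℕ} {U : Submodule F E} {a : Fin k → E} (h : ∀ i, a i ∈ U) :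
    exteriorPower.ιMulti F k a ∈ subPower k U :=
  ⟨exteriorPower.ιMulti F k fun i => (⟨a i, h i⟩ : U), by
    rw [exteriorPower.map_apply_ιMulti]; rfl⟩

/-- Describing the complement as a kernel reduces membership in `U` to evaluating one functional on
the explicit factors. -/
theorem isSplitting_of_dual {k : ℕ} {X : ⋀[F]^(k + 1) E} (hX : support X = ⊤) {v : E}
    {ξ : Dual F E} (hξ : ξ v = 1) {X₁ : ⋀[F]^k E} {X₂ : ⋀[F]^(k + 1) E}
    (h₁ : X₁ ∈ subPower k (LinearMap.ker ξ)) (h₂ : X₂ ∈ subPower (k + 1) (LinearMap.ker ξ))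
    (h : (X : ExteriorAlgebra F E) = X₁ * ι F v + X₂) :
    IsSplitting X v (LinearMap.ker ξ) X₁ X₂ where
  mem_support := hX ▸ trivial
  ne_zero := by rintro rfl; simp at hξ
  inf_eq := by
    rw [Submodule.eq_bot_iff]
    rintro x ⟨hx, hx'⟩
    obtain ⟨c, rfl⟩ := Submodule.mem_span_singleton.1 hx
    have : c = 0 := by simpa [hξ] using hx'
    rw [this, zero_smul]
  sup_eq := by
    rw [hX, eq_top_iff]
    intro x _
    rw [← add_sub_cancel (ξ x • v) x]
    refine Submodule.add_mem_sup (Submodule.smul_mem _ _ (Submodule.mem_span_singleton_self v)) ?_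
    simp [hξ]
  left_mem := h₁
  right_mem := h₂
  eq_add := h

theorem IsSplitting.ι_mul {k : ℕ} {X : ⋀[F]^(k + 1) E} {v U X₁ X₂} (hs : IsSplitting X v U X₁ X₂) :
    ι F v * (X : ExteriorAlgebra F E) = ι F v * X₂ := by
  rw [hs.eq_add, mul_add, ι_mul_mul_ι_self, zero_add]

theorem IsDecomposable.map {E' : Type*} [AddCommGroup E'] [Module F E'] {k : ℕ} {C : ⋀[F]^k E}
    (hC : IsDecomposable C) (f : E →ₗ[F] E') : IsDecomposable (exteriorPower.map k f C) := by
  obtain ⟨a, rfl⟩ := hC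
  exact ⟨f ∘ a, exteriorPower.map_apply_ιMulti f a⟩

theorem sInf_image_length_eq {k n : ℕ} {S : Set (⋀[F]^k E)} (h : ∀ Y ∈ S, n ≤ length Y)
    {Y : ⋀[F]^k E} (hY : Y ∈ S) (hn : length Y ≤ n) : sInf (length '' S) = n := by
  refine le_antisymm ((Nat.sInf_le (Set.mem_image_of_mem _ hY)).trans hn) ?_
  refine le_csInf (Set.Nonempty.image _ ⟨Y, hY⟩) ?_
  rintro _ ⟨Z, hZ, rfl⟩
  exact h Z hZ

end Length

/-! ### Lower bounds by dimension counts -/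

section LowerBounds

variable {F E : Type*} [Field F] [AddCommGroup E] [Module F E]

/-- For `v ≠ 0` few vectors `w` satisfy `w ∧ v ∧ X = 0`. -/
def SmallAnnihilators (X : ⋀[F]^4 E) (n : ℕ) : Prop :=
  ∀ v : E, v ≠ 0 → ∀ P : Submodule F E,
    (∀ w ∈ P, ι F w * (ι F v * (X : ExteriorAlgebra F E)) = 0) → finrank F P ≤ n

variable {X : ⋀[F]^4 E}

theorem SmallAnnihilators.mono {n m : ℕ} (h : SmallAnnihilators X n) (hnm : n ≤ m) :
    SmallAnnihilators X m := fun v hv P hP => (h v hv P hP).trans hnm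

variable [FiniteDimensional F E]

theorem SmallAnnihilators.ι_mul_ne (hE : finrank F E = 7) (h : SmallAnnihilators X 4) {v : E}
    (hv : v ≠ 0) {C : ⋀[F]^4 E} (hC : IsDecomposable C) :
    ι F v * (X : ExteriorAlgebra F E) ≠ ι F v * C := by
  intro he
  obtain ⟨P, hP, hP'⟩ := hC.exists_annihilator_ι_mul (by omega) v
  have := h v hv P fun w hw => by rw [he, hP' w hw]
  omega

theorem SmallAnnihilators.ι_mul_ne_add (hE : finrank F E = 7) (h : SmallAnnihilators X 1) {v : E}
    (hv : v ≠ 0) {C D : ⋀[F]^4 E} (hC : IsDecomposable C) (hD : IsDecomposable D) :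
    ι F v * (X : ExteriorAlgebra F E) ≠ ι F v * C + ι F v * D := by
  intro he
  obtain ⟨P, hP, hP'⟩ := hC.exists_annihilator_ι_mul (by omega) v
  obtain ⟨Q, hQ, hQ'⟩ := hD.exists_annihilator_ι_mul (by omega) v
  have := h v hv (P ⊓ Q) fun w hw => by rw [he, mul_add, hP' w hw.1, hQ' w hw.2, add_zero]
  have := le_finrank_inf hP hQ hE
  omega

/-- Two decomposable four-vectors in a space of dimension seven have a common factor. -/
theorem exists_common_factor (hE : finrank F E = 7) {C D : ⋀[F]^4 E}
    (hC : IsDecomposable C) (hD : IsDecomposable D) :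
    ∃ v : E, v ≠ 0 ∧ ι F v * (C : ExteriorAlgebra F E) = 0 ∧
      ι F v * (D : ExteriorAlgebra F E) = 0 := by
  obtain ⟨P, hP, hP'⟩ := hC.exists_annihilator (by omega)
  obtain ⟨Q, hQ, hQ'⟩ := hD.exists_annihilator (by omega)
  have := le_finrank_inf hP hQ hE
  obtain ⟨v, hv, hv0⟩ := exists_ne_zero_of_finrank_pos (P := P ⊓ Q) (by omega)
  exact ⟨v, hv0, hP' v hv.1, hQ' v hv.2⟩

/-- With three summands, wedging with a common factor of two of them leaves one. -/
theorem SmallAnnihilators.four_le_length (hE : finrank F E = 7) (h : SmallAnnihilators X 4) :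
    4 ≤ length X := by
  by_contra! hc
  obtain ⟨Y, hY, hX⟩ := (length_le_iff (n := 3) X).1 (by omega)
  obtain ⟨v, hv, h0, h1⟩ := exists_common_factor hE (hY 0) (hY 1)
  refine h.ι_mul_ne hE hv (hY 2) ?_
  rw [hX, Fin.sum_univ_three]
  simp [mul_add, h0, h1]

theorem SmallAnnihilators.five_le_length (hE : finrank F E = 7) (h : SmallAnnihilators X 1) :
    5 ≤ length X := by
  by_contra! hc
  obtain ⟨Y, hY, hX⟩ := (length_le_iff (n := 4) X).1 (by omega)
  obtain ⟨v, hv, h0, h1⟩ := exists_common_factor hE (hY 0) (hY 1)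
  refine h.ι_mul_ne_add hE hv (hY 2) (hY 3) ?_
  rw [hX, Fin.sum_univ_four]
  simp [mul_add, h0, h1]

/-- If `X` came from a proper subspace, it would come from a hyperplane `H`. Then `w ↦ w ∧ p ∧ X`
would map `H` into a line for `p ∈ H`, leaving a kernel of dimension at least 5. -/
theorem SmallAnnihilators.support_eq_top (hE : finrank F E = 7) (h : SmallAnnihilators X 4) :
    support X = ⊤ := by
  refine sInf_eq_top.2 fun U hU => ?_
  by_contra hne
  obtain ⟨ξ, hξ, hle⟩ := Submodule.exists_le_ker_of_lt_top U (lt_top_iff_ne_top.2 hne)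
  have h6 : finrank F (LinearMap.ker ξ) = 6 := by
    have := Module.Dual.finrank_ker_add_one_of_ne_zero hξ
    omega
  obtain ⟨p, hp, hp0⟩ := exists_ne_zero_of_finrank_pos (P := LinearMap.ker ξ) (by omega)
  obtain ⟨P, -, hP, hP'⟩ := exists_annihilator_of_mem_subPower h6 (subPower_mono hle hU) hp _ le_rfl
  have := h p hp0 P hP'
  omega

theorem SmallAnnihilators.rank_eq (hE : finrank F E = 7) (h : SmallAnnihilators X 4) :
    rank X = 7 := by
  rw [rank, h.support_eq_top hE, finrank_top, hE]

theorem SmallAnnihilators.two_le_length_right (hE : finrank F E = 7) (h : SmallAnnihilators X 4)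
    {v U X₁ X₂} (hs : IsSplitting X v U X₁ X₂) : 2 ≤ length X₂ := by
  by_contra! hc
  obtain ⟨Y, hY, hX⟩ := (length_le_iff (n := 1) X₂).1 (by omega)
  refine h.ι_mul_ne hE hs.ne_zero (hY 0) ?_
  rw [hs.ι_mul, hX, Fin.sum_univ_one]

theorem SmallAnnihilators.three_le_length_right (hE : finrank F E = 7) (h : SmallAnnihilators X 1)
    {v U X₁ X₂} (hs : IsSplitting X v U X₁ X₂) : 3 ≤ length X₂ := by
  by_contra! hc
  obtain ⟨Y, hY, hX⟩ := (length_le_iff (n := 2) X₂).1 (by omega)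
  refine h.ι_mul_ne_add hE hs.ne_zero (hY 0) (hY 1) ?_
  rw [hs.ι_mul, hX, Fin.sum_univ_two, Submodule.coe_add, mul_add]

theorem IsSplitting.finrank_eq (hE : finrank F E = 7) (h : SmallAnnihilators X 4)
    {v U X₁ X₂} (hs : IsSplitting X v U X₁ X₂) : finrank F U = 6 :=
  finrank_eq_six_of_isCompl_span hE hs.ne_zero hs.inf_eq
    (hs.sup_eq.trans (h.support_eq_top hE))

theorem SmallAnnihilators.two_le_length_left (hE : finrank F E = 7) (h : SmallAnnihilators X 4)
    {v U X₁ X₂} (hs : IsSplitting X v U X₁ X₂) : 2 ≤ length X₁ := by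
  by_contra! hc
  obtain ⟨Y, hY, hX⟩ := (length_le_iff (n := 1) X₁).1 (by omega)
  rw [Fin.sum_univ_one] at hX
  have hU := hs.finrank_eq hE h
  obtain ⟨P, hP, hP'⟩ := (hY 0).exists_annihilator (by omega)
  -- Since `3 + 6 > 7`, some nonzero `p ∈ U` kills `X₁`. Then `p ∧ X = p ∧ X₂`, whose annihilator in
  -- `U` has dimension at least 5.
  have := le_finrank_inf hP hU.ge hE
  obtain ⟨p, hp, hp0⟩ := exists_ne_zero_of_finrank_pos (P := P ⊓ U) (by omega)
  obtain ⟨Q, -, hQ, hQ'⟩ := exists_annihilator_of_mem_subPower hU hs.right_mem hp.2 _ le_rfl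
  have := h p hp0 Q fun w hw => by
    rw [hs.eq_add, hX, mul_add, ← mul_assoc _ _ (ι F v), hP' p hp.1, zero_mul, zero_add, hQ' w hw]
  omega

/-- A decomposable `k`-vector in `Λ^k U` is annihilated by a `k`-dimensional subspace of `U`. -/
theorem IsDecomposable.exists_annihilator_le {U : Submodule F E} {k : ℕ} (hk : k ≤ finrank F U)
    {C : ⋀[F]^k U} (hC : IsDecomposable C) :
    ∃ P ≤ U, k ≤ finrank F P ∧ ∀ p ∈ P,
      ι F p * ((exteriorPower.map k U.subtype C : ⋀[F]^k E) : ExteriorAlgebra F E) = 0 := by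
  obtain ⟨P, hP, hP'⟩ := hC.exists_annihilator hk
  refine ⟨P.map U.subtype, Submodule.map_subtype_le _ _, ?_, ?_⟩
  · rwa [Submodule.finrank_map_subtype_eq]
  · rintro _ ⟨p, hp, rfl⟩
    obtain ⟨a, rfl⟩ := hC
    have := congrArg (ExteriorAlgebra.map U.subtype) (hP' p hp)
    rw [exteriorPower.ιMulti_apply_coe, map_mul, ExteriorAlgebra.map_apply_ι,
      ExteriorAlgebra.map_apply_ιMulti, map_zero] at this
    rw [exteriorPower.map_apply_ιMulti, exteriorPower.ιMulti_apply_coe]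
    exact this

/-- Let `p ∈ U` kill the first summand of `X₁` and let `Q ≤ U` be a 3-dimensional space killing the
second. For `w ∈ Q` only `w ∧ p ∧ X₂` survives in `w ∧ p ∧ X`. It lies in a line, so at least a
plane of such `w` annihilates `p ∧ X`. -/
theorem SmallAnnihilators.three_le_length_left (hE : finrank F E = 7) (h : SmallAnnihilators X 1)
    {v U X₁ X₂} (hs : IsSplitting X v U X₁ X₂) : 3 ≤ length X₁ := by
  by_contra! hc
  obtain ⟨Y, hY, hX⟩ := (length_le_iff (n := 2) X₁).1 (by omega)
  have hU := hs.finrank_eq hE (h.mono (by norm_num))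
  -- The summands of `X₁` need not lie in `Λ^3 U`. Projecting to `U` fixes `X₁` and keeps them
  -- decomposable.
  obtain ⟨π, hπ⟩ := U.subtype.exists_leftInverse_of_injective U.ker_subtype
  have hX' : X₁ = exteriorPower.map 3 U.subtype (exteriorPower.map 3 π (Y 0)) +
      exteriorPower.map 3 U.subtype (exteriorPower.map 3 π (Y 1)) := by
    obtain ⟨Z, rfl⟩ := hs.left_mem
    rw [← map_add, ← map_add, ← Fin.sum_univ_two, ← hX,
      ← LinearMap.comp_apply (exteriorPower.map 3 π),
      ← exteriorPower.map_comp, hπ, exteriorPower.map_id, LinearMap.id_apply]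
  obtain ⟨P, hPU, hP, hP'⟩ := ((hY 0).map π).exists_annihilator_le (by omega)
  obtain ⟨Q, hQU, hQ, hQ'⟩ := ((hY 1).map π).exists_annihilator_le (by omega)
  obtain ⟨p, hp, hp0⟩ := exists_ne_zero_of_finrank_pos (P := P) (by omega)
  obtain ⟨R, hR, hR', hR''⟩ := exists_annihilator_of_mem_subPower hU hs.right_mem (hPU hp) Q hQU
  have := h p hp0 R fun w hw => by
    rw [hs.eq_add, hX', mul_add, ← mul_assoc _ _ (ι F v), Submodule.coe_add, mul_add (ι F p),
      hP' p hp, zero_add, mul_add, hR'' w hw, add_zero, ← mul_assoc, ← mul_assoc,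
      ι_mul_ι_swap, neg_mul, mul_assoc (ι F p), hQ' w (hR hw), mul_zero, neg_zero, zero_mul]
  omega

end LowerBounds

/-! ### From bounds to the values of the invariants -/

section Values

variable {F E : Type*} [Field F] [AddCommGroup E] [Module F E] [FiniteDimensional F E]
  {X : ⋀[F]^4 E}

theorem invariants_of_smallAnnihilators_four (hE : finrank F E = 7) (h : SmallAnnihilators X 4)
    (hl : length X ≤ 4) {v U X₁ X₂ v' U' X₁' X₂'} (hs : IsSplitting X v U X₁ X₂)
    (hm : length X₁ ≤ 2) (hs' : IsSplitting X v' U' X₁' X₂') (hr : length X₂' ≤ 2) :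
    (rank X, length X, invM X, invR X) = (7, 4, 2, 2) := by
  rw [h.rank_eq hE, hl.antisymm (h.four_le_length hE), invM, invR,
    sInf_image_length_eq (S := setD X) (n := 2) ?_ ⟨v, U, X₂, hs⟩ hm,
    sInf_image_length_eq (S := setE X) (n := 2) ?_ ⟨v', U', X₁', hs'⟩ hr]
  · rintro _ ⟨v, U, Y, hs⟩
    exact h.two_le_length_right hE hs
  · rintro _ ⟨v, U, Y, hs⟩
    exact h.two_le_length_left hE hs

theorem invariants_of_smallAnnihilators_one (hE : finrank F E = 7) (h : SmallAnnihilators X 1)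
    (hl : length X ≤ 5) {v U X₁ X₂} (hs : IsSplitting X v U X₁ X₂)
    (hm : length X₁ ≤ 3) (hr : length X₂ ≤ 3) :
    (rank X, length X, invM X, invR X) = (7, 5, 3, 3) := by
  rw [(h.mono (by norm_num)).rank_eq hE, hl.antisymm (h.five_le_length hE), invM, invR,
    sInf_image_length_eq (S := setD X) (n := 3) ?_ ⟨v, U, X₂, hs⟩ hm,
    sInf_image_length_eq (S := setE X) (n := 3) ?_ ⟨v, U, X₁, hs⟩ hr]
  · rintro _ ⟨v, U, Y, hs⟩
    exact h.three_le_length_right hE hs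
  · rintro _ ⟨v, U, Y, hs⟩
    exact h.three_le_length_left hE hs

end Values

/-! ### The dual four-form and its cross product -/

section FourForms

variable {F E : Type*} [Field F] [AddCommGroup E] [Module F E]

/-- The condition `i < j` orients anticommutation, so that rewriting sorts monomials by increasing
index and terminates. -/
theorem ι_mul_ι_of_lt (b : Fin 7 → E) {i j : Fin 7} (_ : i < j) :
    ι F (b j) * ι F (b i) = -(ι F (b i) * ι F (b j)) := ι_mul_ι_swap _ _

theorem ι_mul_ι_mul_of_lt (b : Fin 7 → E) {i j : Fin 7} (_ : i < j) (z : ExteriorAlgebra F E) :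
    ι F (b j) * (ι F (b i) * z) = -(ι F (b i) * (ι F (b j) * z)) := ι_mul_ι_mul_swap _ _ _

theorem coe_ιMulti_three (a b c : E) :
    (exteriorPower.ιMulti F 3 ![a, b, c] : ExteriorAlgebra F E) = ι F a * (ι F b * ι F c) := by
  simp [ExteriorAlgebra.ιMulti_apply]

theorem coe_ιMulti_four (a b c d : E) :
    (exteriorPower.ιMulti F 4 ![a, b, c, d] : ExteriorAlgebra F E) =
      ι F a * (ι F b * (ι F c * ι F d)) := by
  simp [ExteriorAlgebra.ιMulti_apply]

theorem coe_ιMulti_seven (b : Fin 7 → E) :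
    (exteriorPower.ιMulti F 7 b : ExteriorAlgebra F E) = ι F (b 0) * (ι F (b 1) * (ι F (b 2) *
      (ι F (b 3) * (ι F (b 4) * (ι F (b 5) * ι F (b 6)))))) := by
  simp [ExteriorAlgebra.ιMulti_apply]
  rfl

/-- The four-form dual to `g2Form` (for `s = 1`) and to `g2StarForm` (for `s = -1`). -/
noncomputable def fourForm (s : F) (b : Fin 7 → E) : ⋀[F]^4 E :=
  exteriorPower.ιMulti F 4 ![b 0, b 1, b 2, b 3]
    + s • exteriorPower.ιMulti F 4 ![b 0, b 1, b 4, b 5]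
    + s • exteriorPower.ιMulti F 4 ![b 2, b 3, b 4, b 5]
    + exteriorPower.ιMulti F 4 ![b 0, b 2, b 5, b 6]
    + exteriorPower.ιMulti F 4 ![b 0, b 3, b 4, b 6]
    + exteriorPower.ιMulti F 4 ![b 1, b 2, b 4, b 6]
    - exteriorPower.ιMulti F 4 ![b 1, b 3, b 5, b 6]

/-- The components of the cross product of two vectors. -/
def cross (s : F) (w v : Fin 7 → F) : Fin 7 → F :=
  ![s * w 1 * v 6 + w 2 * v 4 - w 3 * v 5 - w 4 * v 2 + w 5 * v 3 - s * w 6 * v 1,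
    -(s * w 0 * v 6) - w 2 * v 5 - w 3 * v 4 + w 4 * v 3 + w 5 * v 2 + s * w 6 * v 0,
    -(w 0 * v 4) + w 1 * v 5 + s * w 3 * v 6 + w 4 * v 0 - w 5 * v 1 - s * w 6 * v 3,
    w 0 * v 5 + w 1 * v 4 - s * w 2 * v 6 - w 4 * v 1 - w 5 * v 0 + s * w 6 * v 2,
    w 0 * v 2 - w 1 * v 3 - w 2 * v 0 + w 3 * v 1 + w 5 * v 6 - w 6 * v 5,
    -(w 0 * v 3) - w 1 * v 2 + w 2 * v 1 + w 3 * v 0 - w 4 * v 6 + w 6 * v 4,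
    s * w 0 * v 1 - s * w 1 * v 0 + s * w 2 * v 3 - s * w 3 * v 2 + w 4 * v 5 - w 5 * v 4]

theorem ι_mul_ι_mul_ι_mul_fourForm (s : F) (b : Fin 7 → E) (w v : Fin 7 → F) (j : Fin 7) :
    ι F (b j) * (ι F (∑ i, w i • b i) * (ι F (∑ i, v i • b i) *
      (fourForm s b : ExteriorAlgebra F E))) =
      cross s w v j • (exteriorPower.ιMulti F 7 b : ExteriorAlgebra F E) := by
  simp only [fourForm, Fin.sum_univ_seven, Submodule.coe_add, Submodule.coe_sub, Submodule.coe_smul,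
    coe_ιMulti_four, map_add, map_smul, add_mul, mul_add, mul_sub, smul_mul_assoc, mul_smul_comm]
  simp (discharger := decide) only [ι_mul_ι_of_lt, ι_mul_ι_mul_of_lt, ι_sq_zero, ι_mul_ι_mul_self,
    mul_neg, neg_neg, mul_zero, smul_zero, neg_zero, add_zero, zero_add, smul_neg]
  rw [coe_ιMulti_seven]
  fin_cases j <;>
  simp (discharger := decide) only [Fin.zero_eta, Fin.mk_one, Fin.reduceFinMk, cross,
    ι_mul_ι_of_lt, ι_mul_ι_mul_of_lt, ι_sq_zero, ι_mul_ι_mul_self, mul_neg, neg_neg, mul_zero,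
    smul_zero, neg_zero, add_zero, zero_add, smul_neg, sub_zero, Matrix.cons_val] <;>
  module

end FourForms

/-! ### The metric and the size of the annihilators -/

section Metric

variable {F E : Type*} [Field F] [AddCommGroup E] [Module F E]

/-- The diagonal entries of the metric of a `G₂`-structure (`s = 1`) or `G₂*`-structure
(`s = -1`) in an adapted basis. -/
def metricSign (s : F) : Fin 7 → F := ![s, s, s, s, 1, 1, 1]

/-- The diagonal metric for which an adapted basis is orthonormal. -/
noncomputable def metric (s : F) (b : Basis (Fin 7) F E) : LinearMap.BilinForm F E :=
  Matrix.toBilin b (Matrix.diagonal (metricSign s))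

theorem metric_apply (s : F) (b : Basis (Fin 7) F E) (v w : E) :
    metric s b v w = ∑ i, metricSign s i * b.repr v i * b.repr w i := by
  rw [metric, Matrix.toBilin_apply]
  refine Finset.sum_congr rfl fun i _ => ?_
  rw [Finset.sum_eq_single i (fun j _ hj => by simp [Matrix.diagonal_apply_ne _ hj.symm]) (by simp),
    Matrix.diagonal_apply_eq, mul_comm (b.repr v i)]

theorem metric_basis (s : F) (b : Basis (Fin 7) F E) (i j : Fin 7) :
    metric s b (b i) (b j) = if i = j then metricSign s i else 0 := by
  rw [metric_apply, Finset.sum_eq_single i (fun k _ hk => by simp [hk]) (by simp)]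
  simp [Finsupp.single_apply, eq_comm]

theorem metricSign_sq {s : F} (hs : s = 1 ∨ s = -1) (i : Fin 7) :
    metricSign s i * metricSign s i = 1 := by
  rcases hs with rfl | rfl <;> fin_cases i <;> simp [metricSign]

theorem det_metricSign {s : F} (hs : s = 1 ∨ s = -1) :
    (Matrix.diagonal (metricSign s)).det = 1 := by
  rcases hs with rfl | rfl <;> simp [Fin.prod_univ_seven, metricSign]

theorem metric_nondegenerate {s : F} (hs : s = 1 ∨ s = -1) (b : Basis (Fin 7) F E) :
    (metric s b).Nondegenerate := by
  refine Matrix.Nondegenerate.toBilin ?_ b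
  rw [Matrix.nondegenerate_iff_det_ne_zero, det_metricSign hs]
  exact one_ne_zero

theorem metric_comm (s : F) (b : Basis (Fin 7) F E) (v w : E) :
    metric s b v w = metric s b w v := by
  simp only [metric_apply]
  exact Finset.sum_congr rfl fun i _ => by ring

theorem ιMulti_basis_ne_zero {n : ℕ} (b : Basis (Fin n) F E) :
    exteriorPower.ιMulti F n b ≠ 0 := by
  intro h
  have := exteriorPower.alternatingMapLinearEquiv_apply_ιMulti b.det b
  rw [h, map_zero, b.det_self] at this
  exact zero_ne_one this

theorem cross_eq_zero {s : F} (b : Basis (Fin 7) F E) {w v : E}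
    (h : ι F w * (ι F v * (fourForm s b : ExteriorAlgebra F E)) = 0) (j : Fin 7) :
    cross s (b.repr w) (b.repr v) j = 0 := by
  have h' := ι_mul_ι_mul_ι_mul_fourForm s b (b.repr w) (b.repr v) j
  rw [b.sum_repr, b.sum_repr, h, mul_zero] at h'
  refine (smul_eq_zero.1 h'.symm).resolve_right ?_
  simpa only [ne_eq, Submodule.coe_eq_zero] using ιMulti_basis_ne_zero b

/-- The identity `v × (v × w) = ⟨v, w⟩ v - ⟨v, v⟩ w` in the case `v × w = 0`. -/
theorem sum_mul_eq_of_cross_eq_zero {s : F} (hs : s = 1 ∨ s = -1) {w v : Fin 7 → F}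
    (h : ∀ j, cross s w v j = 0) (i : Fin 7) :
    (∑ k, metricSign s k * v k * v k) * w i = (∑ k, metricSign s k * v k * w k) * v i := by
  have h0 := h 0
  have h1 := h 1
  have h2 := h 2
  have h3 := h 3
  have h4 := h 4
  have h5 := h 5
  have h6 := h 6
  simp only [cross, Matrix.cons_val] at h0 h1 h2 h3 h4 h5 h6
  simp only [metricSign, Fin.sum_univ_seven, Matrix.cons_val]
  -- The coefficients are those of a second cross product with `v`. For `s = -1` its indices are
  -- raised by the metric, which accounts for the factors `-1`.
  rcases hs with rfl | rfl
  · fin_cases i <;> simp only [Fin.zero_eta, Fin.mk_one, Fin.reduceFinMk]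
    · linear_combination - v 6 * h1 - v 4 * h2 + v 5 * h3 + v 2 * h4 - v 3 * h5 + v 1 * h6
    · linear_combination v 6 * h0 + v 5 * h2 + v 4 * h3 - v 3 * h4 - v 2 * h5 - v 0 * h6
    · linear_combination v 4 * h0 - v 5 * h1 - v 6 * h3 - v 0 * h4 + v 1 * h5 + v 3 * h6
    · linear_combination - v 5 * h0 - v 4 * h1 + v 6 * h2 + v 1 * h4 + v 0 * h5 - v 2 * h6
    · linear_combination - v 2 * h0 + v 3 * h1 + v 0 * h2 - v 1 * h3 - v 6 * h5 + v 5 * h6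
    · linear_combination v 3 * h0 + v 2 * h1 - v 1 * h2 - v 0 * h3 + v 6 * h4 - v 4 * h6
    · linear_combination - v 1 * h0 + v 0 * h1 - v 3 * h2 + v 2 * h3 - v 5 * h4 + v 4 * h5
  · fin_cases i <;> simp only [Fin.zero_eta, Fin.mk_one, Fin.reduceFinMk]
    · linear_combination - (-1) * v 6 * h1 - v 4 * h2 + v 5 * h3
        + (-1) * v 2 * h4 - (-1) * v 3 * h5 + v 1 * h6
    · linear_combination (-1) * v 6 * h0 + v 5 * h2
        + v 4 * h3 - (-1) * v 3 * h4 - (-1) * v 2 * h5 - v 0 * h6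
    · linear_combination v 4 * h0 - v 5 * h1 - (-1) * v 6 * h3 - (-1) * v 0 * h4
        + (-1) * v 1 * h5 + v 3 * h6
    · linear_combination - v 5 * h0 - v 4 * h1 + (-1) * v 6 * h2 + (-1) * v 1 * h4
        + (-1) * v 0 * h5 - v 2 * h6
    · linear_combination - (-1) * v 2 * h0 + (-1) * v 3 * h1
        + (-1) * v 0 * h2 - (-1) * v 1 * h3 - v 6 * h5 + v 5 * h6
    · linear_combination (-1) * v 3 * h0 + (-1) * v 2 * h1 - (-1) * v 1 * h2
        - (-1) * v 0 * h3 + v 6 * h4 - v 4 * h6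
    · linear_combination - v 1 * h0 + v 0 * h1 - v 3 * h2 + v 2 * h3 - v 5 * h4 + v 4 * h5

theorem metric_smul_eq {s : F} (hs : s = 1 ∨ s = -1) (b : Basis (Fin 7) F E) {w v : E}
    (h : ι F w * (ι F v * (fourForm s b : ExteriorAlgebra F E)) = 0) :
    metric s b v v • w = metric s b v w • v := by
  apply b.repr.injective
  ext i
  simpa [metric_apply] using sum_mul_eq_of_cross_eq_zero hs (cross_eq_zero b h) i

theorem finrank_le_one_of_ι_mul_ι_mul_eq_zero {s : F} (hs : s = 1 ∨ s = -1)
    (b : Basis (Fin 7) F E) {v : E} (hv : metric s b v v ≠ 0) {P : Submodule F E}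
    (hP : ∀ w ∈ P, ι F w * (ι F v * (fourForm s b : ExteriorAlgebra F E)) = 0) :
    finrank F P ≤ 1 := by
  refine (Submodule.finrank_mono (t := Submodule.span F {v}) fun w hw => ?_).trans
    ((finrank_span_le_card {v}).trans (by simp))
  refine Submodule.mem_span_singleton.2 ⟨(metric s b v v)⁻¹ * metric s b v w, ?_⟩
  rw [mul_smul, ← metric_smul_eq hs b (hP w hw), smul_smul, inv_mul_cancel₀ hv, one_smul]

theorem smallAnnihilators_fourForm [CharZero F] [FiniteDimensional F E] {s : F}
    (hs : s = 1 ∨ s = -1) (b : Basis (Fin 7) F E) : SmallAnnihilators (fourForm s b) 4 := by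
  intro v hv P hP
  by_cases hvv : metric s b v v = 0
  · have hvw : ∀ w ∈ P, metric s b v w = 0 := fun w hw => by
      have := metric_smul_eq hs b (hP w hw)
      rw [hvv, zero_smul] at this
      exact (smul_eq_zero.1 this.symm).resolve_right hv
    -- The condition is symmetric in `v` and `w`, so the identity also applies with their roles
    -- exchanged. Polarization then makes `P` totally isotropic.
    have hww : ∀ w ∈ P, metric s b w w = 0 := fun w hw => by
      have h := hP w hw
      rw [ι_mul_ι_mul_swap, neg_eq_zero] at h
      have := metric_smul_eq hs b h
      rw [metric_comm s b w v, hvw w hw, zero_smul] at this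
      exact (smul_eq_zero.1 this).resolve_right hv
    have hle : P ≤ (metric s b).orthogonal P := by
      intro w hw u hu
      have := hww (w + u) (P.add_mem hw hu)
      rw [map_add, map_add, LinearMap.add_apply, LinearMap.add_apply, hww w hw, hww u hu,
        metric_comm s b w u, zero_add, add_zero, ← two_mul] at this
      exact (mul_eq_zero.1 this).resolve_left two_ne_zero
    have h1 := Submodule.finrank_mono hle
    rw [LinearMap.BilinForm.finrank_orthogonal (metric_nondegenerate hs b),
      finrank_eq_card_basis b, Fintype.card_fin] at h1
    omega
  · exact (finrank_le_one_of_ι_mul_ι_mul_eq_zero hs b hvv hP).trans (by norm_num)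

theorem smallAnnihilators_fourForm_one {E : Type*} [AddCommGroup E] [Module ℝ E]
    (b : Basis (Fin 7) ℝ E) : SmallAnnihilators (fourForm (1 : ℝ) b) 1 := by
  intro v hv P hP
  refine finrank_le_one_of_ι_mul_ι_mul_eq_zero (Or.inl rfl) b (fun h => hv ?_) hP
  have h1 : metricSign (1 : ℝ) = 1 := by
    ext i
    fin_cases i <;> rfl
  simp only [metric_apply, h1, Pi.one_apply, one_mul] at h
  rw [Finset.sum_eq_zero_iff_of_nonneg fun i _ => mul_self_nonneg _] at h
  apply b.repr.injective
  ext i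
  simpa using h i (Finset.mem_univ i)

end Metric

/-! ### Explicit decompositions and the upper bounds -/

section Values

variable {F E : Type*} [Field F] [AddCommGroup E] [Module F E]

theorem length_sum_le {k n : ℕ} (a : Fin n → Fin (k + 1) → E) :
    length (∑ i, exteriorPower.ιMulti F (k + 1) (a i)) ≤ n :=
  (length_le_iff _).2 ⟨_, fun i => ⟨a i, rfl⟩, rfl⟩

theorem length_fourForm_one_le (b : Fin 7 → E) : length (fourForm (1 : F) b) ≤ 5 := by
  -- The last three terms carry the monomials without `b 6`, two of them with `b 0`, `b 1` shifted
  -- by `± b 6`. The extra monomials cancel against the first two terms, which collect everything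
  -- divisible by `b 6`.
  suffices h : fourForm (1 : F) b = ∑ i, exteriorPower.ιMulti F 4
      (![![-b 1, b 3 + b 4, b 2 + b 5, b 6], ![b 0, b 3 + b 5, b 4 - b 2, b 6],
        ![b 0 + b 6, b 1 - b 6, b 2, b 3], ![b 0 - b 6, b 1 + b 6, b 4, b 5],
        ![b 2, b 3, b 4, b 5]] i) by
    rw [h]; exact length_sum_le _
  apply Subtype.ext
  simp only [fourForm, Fin.sum_univ_five, Matrix.cons_val, Submodule.coe_add, Submodule.coe_sub,
    coe_ιMulti_four, map_add, map_sub, map_neg, add_mul, mul_add, mul_sub,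
    sub_mul, neg_mul, one_smul]
  simp (discharger := decide) only [ι_mul_ι_of_lt, ι_mul_ι_mul_of_lt, ι_sq_zero, mul_neg, neg_neg,
    mul_zero, neg_zero, add_zero, sub_zero]
  abel

theorem length_fourForm_neg_one_le [CharZero F] (b : Fin 7 → E) :
    length (fourForm (-1 : F) b) ≤ 4 := by
  -- The factors are built from `b 0` and the null vectors `b 1 ± b 6`, `b 2 ± b 4`, `b 3 ± b 5`.
  suffices h : fourForm (-1 : F) b = ∑ i, exteriorPower.ιMulti F 4
      (![![(1 / 4 : F) • (b 1 + b 6), 2 • b 0 - (b 1 - b 6), b 3 + b 5, b 2 - b 4],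
        ![(1 / 4 : F) • (b 1 + b 6), b 1 - b 6, b 3 + b 5 + (b 2 + b 4), b 2 - b 4 - (b 3 - b 5)],
        ![(-1 / 4 : F) • (2 • b 0 + (b 1 + b 6)), b 2 + b 4, b 1 - b 6, b 3 - b 5],
        ![(-1 / 4 : F) • (b 2 + b 4), b 3 + b 5, b 2 - b 4, b 3 - b 5]] i) by
    rw [h]; exact length_sum_le _
  apply Subtype.ext
  simp only [fourForm, Fin.sum_univ_four, Matrix.cons_val, Submodule.coe_add, Submodule.coe_sub,
    Submodule.coe_smul, coe_ιMulti_four, map_add, map_sub, map_nsmul, map_smul, add_mul, mul_add,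
    mul_sub, sub_mul, smul_mul_assoc, mul_smul_comm]
  simp (discharger := decide) only [ι_mul_ι_of_lt, ι_mul_ι_mul_of_lt, ι_sq_zero, ι_mul_ι_mul_self,
    mul_neg, neg_neg, mul_zero, neg_zero, add_zero, zero_add, sub_zero, smul_neg, smul_zero]
  module

theorem invariants_fourForm_one {E : Type*} [AddCommGroup E] [Module ℝ E]
    (b : Basis (Fin 7) ℝ E) :
    (rank (fourForm (1 : ℝ) b), length (fourForm (1 : ℝ) b), invM (fourForm (1 : ℝ) b),
      invR (fourForm (1 : ℝ) b)) =
      (7, 5, 3, 3) := by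
  have : FiniteDimensional ℝ E := b.finiteDimensional_of_finite
  have hE : finrank ℝ E = 7 := by rw [finrank_eq_card_basis b, Fintype.card_fin]
  have h := smallAnnihilators_fourForm_one b
  -- This one splitting attains both minima.
  have hs : IsSplitting (fourForm (1 : ℝ) b) (b 6) (LinearMap.ker (b.coord 6))
      (∑ i, exteriorPower.ιMulti ℝ 3 (![![b 0, b 3 + b 2, b 5 + b 4], ![-(b 1 + b 0), b 3, b 5],
        ![b 1 - b 0, b 2, b 4]] i))
      (∑ i, exteriorPower.ιMulti ℝ 4 (![![b 0, b 1, b 2, b 3], ![b 0, b 1, b 4, b 5],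
        ![b 2, b 3, b 4, b 5]] i)) := by
    refine isSplitting_of_dual ((h.mono (by norm_num)).support_eq_top hE) (by simp)
      (Submodule.sum_mem _ fun i _ => ιMulti_mem_subPower fun j => ?_)
      (Submodule.sum_mem _ fun i _ => ιMulti_mem_subPower fun j => ?_) ?_
    · fin_cases i <;> fin_cases j <;> simp
    · fin_cases i <;> fin_cases j <;> simp
    · simp only [fourForm, Fin.sum_univ_three, Matrix.cons_val, Submodule.coe_add,
        Submodule.coe_sub, coe_ιMulti_four, coe_ιMulti_three, map_add, map_sub,
        map_neg, add_mul, mul_add, sub_mul, neg_mul, one_smul, mul_assoc]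
      abel
  exact invariants_of_smallAnnihilators_one hE h (length_fourForm_one_le b) hs (length_sum_le _)
    (length_sum_le _)

theorem invariants_fourForm_neg_one [CharZero F] (b : Basis (Fin 7) F E) :
    (rank (fourForm (-1 : F) b), length (fourForm (-1 : F) b), invM (fourForm (-1 : F) b),
      invR (fourForm (-1 : F) b)) = (7, 4, 2, 2) := by
  have : FiniteDimensional F E := b.finiteDimensional_of_finite
  have hE : finrank F E = 7 := by rw [finrank_eq_card_basis b, Fintype.card_fin]
  have h := smallAnnihilators_fourForm (Or.inr rfl) b
  have hs : IsSplitting (fourForm (-1 : F) b) (b 0) (LinearMap.ker (b.coord 0))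
      (∑ i, exteriorPower.ιMulti F 3
        (![![(1 / 2 : F) • (b 1 + b 6), b 3 + b 5, b 2 - b 4],
          ![(1 / 2 : F) • (b 2 + b 4), b 1 - b 6, b 3 - b 5]] i))
      (∑ i, exteriorPower.ιMulti F 4
        (![![(-1 / 4 : F) • (b 1 + b 6), b 2 + b 4, b 1 - b 6, b 2 - b 4],
          ![(1 / 4 : F) • (b 1 + b 6), b 3 + b 5, b 1 - b 6, b 3 - b 5],
          ![(-1 / 4 : F) • (b 2 + b 4), b 3 + b 5, b 2 - b 4, b 3 - b 5]] i)) := by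
    refine isSplitting_of_dual (h.support_eq_top hE) (by simp)
      (Submodule.sum_mem _ fun i _ => ιMulti_mem_subPower fun j => ?_)
      (Submodule.sum_mem _ fun i _ => ιMulti_mem_subPower fun j => ?_) ?_
    · fin_cases i <;> fin_cases j <;> simp
    · fin_cases i <;> fin_cases j <;> simp
    · simp only [fourForm, Fin.sum_univ_three, Fin.sum_univ_two, Matrix.cons_val, Submodule.coe_add,
        Submodule.coe_sub, Submodule.coe_smul, coe_ιMulti_four, coe_ιMulti_three, map_add, map_sub,
        map_smul, add_mul, mul_add, mul_sub, sub_mul, smul_mul_assoc, mul_assoc]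
      simp (discharger := decide) only [ι_mul_ι_of_lt, ι_mul_ι_mul_of_lt, ι_sq_zero,
        ι_mul_ι_mul_self, mul_neg, neg_neg, mul_zero, neg_zero, add_zero, zero_add, smul_neg,
        smul_zero]
      module
  -- A second splitting is needed for `r`: `b 0` is not null, so its annihilator is at most a line
  -- and `X₂` needs three terms. The vector `b 1 + b 6` is null.
  have hs' : IsSplitting (fourForm (-1 : F) b) (b 1 + b 6)
      (LinearMap.ker ((1 / 2 : F) • (b.coord 1 + b.coord 6)))
      (∑ i, exteriorPower.ιMulti F 3
        (![![(1 / 2 : F) • b 0, b 2 - b 4, b 3 + b 5],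
          ![(1 / 4 : F) • (b 2 + b 4), b 1 - b 6, b 2 - b 4],
          ![(-1 / 4 : F) • (b 3 + b 5), b 1 - b 6, b 3 - b 5]] i))
      (∑ i, exteriorPower.ιMulti F 4
        (![![(-1 / 2 : F) • b 0, b 2 + b 4, b 1 - b 6, b 3 - b 5],
          ![(-1 / 4 : F) • (b 2 + b 4), b 3 + b 5, b 2 - b 4, b 3 - b 5]] i)) := by
    refine isSplitting_of_dual (h.support_eq_top hE) (by simp; norm_num)
      (Submodule.sum_mem _ fun i _ => ιMulti_mem_subPower fun j => ?_)
      (Submodule.sum_mem _ fun i _ => ιMulti_mem_subPower fun j => ?_) ?_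
    · fin_cases i <;> fin_cases j <;> simp
    · fin_cases i <;> fin_cases j <;> simp
    · simp only [fourForm, Fin.sum_univ_three, Fin.sum_univ_two, Matrix.cons_val, Submodule.coe_add,
        Submodule.coe_sub, Submodule.coe_smul, coe_ιMulti_four, coe_ιMulti_three, map_add, map_sub,
        map_smul, add_mul, mul_add, mul_sub, sub_mul, smul_mul_assoc, mul_assoc]
      simp (discharger := decide) only [ι_mul_ι_of_lt, ι_mul_ι_mul_of_lt, ι_sq_zero,
        ι_mul_ι_mul_self, mul_neg, neg_neg, mul_zero, neg_zero, add_zero, zero_add, sub_zero,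
        smul_neg, smul_zero]
      module
  exact invariants_of_smallAnnihilators_four hE h (length_fourForm_neg_one_le b) hs
    (length_sum_le _) hs' (length_sum_le _)

end Values

/-! ### The induced metric and volume form -/

section Hodge

variable {F V : Type*} [Field F] [AddCommGroup V] [Module F V]

/-- The three-form `g2Form` (for `s = 1`) or `g2StarForm` (for `s = -1`). -/
noncomputable def threeForm (s : F) (e : Basis (Fin 7) F V) : Form F V 3 :=
  s • exteriorPower.ιMulti F 3 ![e.coord 0, e.coord 1, e.coord 6]
    + s • exteriorPower.ιMulti F 3 ![e.coord 2, e.coord 3, e.coord 6]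
    + exteriorPower.ιMulti F 3 ![e.coord 4, e.coord 5, e.coord 6]
    + exteriorPower.ιMulti F 3 ![e.coord 0, e.coord 2, e.coord 4]
    - exteriorPower.ιMulti F 3 ![e.coord 0, e.coord 3, e.coord 5]
    - exteriorPower.ιMulti F 3 ![e.coord 1, e.coord 2, e.coord 5]
    - exteriorPower.ιMulti F 3 ![e.coord 1, e.coord 3, e.coord 4]

theorem g2Form_eq (e : Basis (Fin 7) F V) : g2Form e = threeForm 1 e := by
  rw [threeForm, one_smul, one_smul]; rfl

theorem g2StarForm_eq (e : Basis (Fin 7) F V) : g2StarForm e = threeForm (-1) e := by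
  have h : ∀ x : Form F V 3, (-1 : F) • x = -x := fun x =>
    Subtype.ext (neg_one_smul F (x : ExteriorAlgebra F (Dual F V)))
  rw [threeForm, h, h, ← sub_eq_add_neg]; rfl

theorem contractLeft_ι_mul_ι_mul_ι (d : Dual F (Dual F V)) (x y z : Dual F V) :
    CliffordAlgebra.contractLeft d (ι F x * (ι F y * ι F z)) =
      d x • (ι F y * ι F z) - d y • (ι F x * ι F z) + d z • (ι F x * ι F y) := by
  erw [CliffordAlgebra.contractLeft_ι_mul, CliffordAlgebra.contractLeft_ι_mul,
    CliffordAlgebra.contractLeft_ι]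
  rw [mul_sub, mul_smul_comm, ← Algebra.commutes, ← Algebra.smul_def, mul_smul_comm]
  abel

/-- The contraction of `threeForm` with the vector with components `v`, in coordinates. -/
noncomputable def contractedForm {E : Type*} [AddCommGroup E] [Module F E] (s : F)
    (b : Fin 7 → E) (v : Fin 7 → F) : ExteriorAlgebra F E :=
  s • (v 0 • (ι F (b 1) * ι F (b 6)) - v 1 • (ι F (b 0) * ι F (b 6))
      + v 6 • (ι F (b 0) * ι F (b 1)))
    + s • (v 2 • (ι F (b 3) * ι F (b 6)) - v 3 • (ι F (b 2) * ι F (b 6))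
      + v 6 • (ι F (b 2) * ι F (b 3)))
    + (v 4 • (ι F (b 5) * ι F (b 6)) - v 5 • (ι F (b 4) * ι F (b 6))
      + v 6 • (ι F (b 4) * ι F (b 5)))
    + (v 0 • (ι F (b 2) * ι F (b 4)) - v 2 • (ι F (b 0) * ι F (b 4))
      + v 4 • (ι F (b 0) * ι F (b 2)))
    - (v 0 • (ι F (b 3) * ι F (b 5)) - v 3 • (ι F (b 0) * ι F (b 5))
      + v 5 • (ι F (b 0) * ι F (b 3)))
    - (v 1 • (ι F (b 2) * ι F (b 5)) - v 2 • (ι F (b 1) * ι F (b 5))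
      + v 5 • (ι F (b 1) * ι F (b 2)))
    - (v 1 • (ι F (b 3) * ι F (b 4)) - v 3 • (ι F (b 1) * ι F (b 4))
      + v 4 • (ι F (b 1) * ι F (b 3)))

theorem contractedForm_mul {E : Type*} [AddCommGroup E] [Module F E] {s : F} (hs : s * s = 1)
    (b : Fin 7 → E) (w : Fin 7 → F) :
    contractedForm s b w * (s • (ι F (b 0) * (ι F (b 1) * ι F (b 6)))
      + s • (ι F (b 2) * (ι F (b 3) * ι F (b 6))) + ι F (b 4) * (ι F (b 5) * ι F (b 6))
      + ι F (b 0) * (ι F (b 2) * ι F (b 4)) - ι F (b 0) * (ι F (b 3) * ι F (b 5))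
      - ι F (b 1) * (ι F (b 2) * ι F (b 5)) - ι F (b 1) * (ι F (b 3) * ι F (b 4))) =
      (2 : F) • (
        w 4 • (ι F (b 0) * (ι F (b 1) * (ι F (b 2) * (ι F (b 3) * ι F (b 4)))))
        + w 5 • (ι F (b 0) * (ι F (b 1) * (ι F (b 2) * (ι F (b 3) * ι F (b 5)))))
        + w 6 • (ι F (b 0) * (ι F (b 1) * (ι F (b 2) * (ι F (b 3) * ι F (b 6)))))
        + w 2 • (ι F (b 0) * (ι F (b 1) * (ι F (b 2) * (ι F (b 4) * ι F (b 5)))))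
        + (s * w 0) • (ι F (b 0) * (ι F (b 1) * (ι F (b 2) * (ι F (b 4) * ι F (b 6)))))
        - (s * w 1) • (ι F (b 0) * (ι F (b 1) * (ι F (b 2) * (ι F (b 5) * ι F (b 6)))))
        + w 3 • (ι F (b 0) * (ι F (b 1) * (ι F (b 3) * (ι F (b 4) * ι F (b 5)))))
        - (s * w 1) • (ι F (b 0) * (ι F (b 1) * (ι F (b 3) * (ι F (b 4) * ι F (b 6)))))
        - (s * w 0) • (ι F (b 0) * (ι F (b 1) * (ι F (b 3) * (ι F (b 5) * ι F (b 6)))))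
        + (s * w 6) • (ι F (b 0) * (ι F (b 1) * (ι F (b 4) * (ι F (b 5) * ι F (b 6)))))
        + w 0 • (ι F (b 0) * (ι F (b 2) * (ι F (b 3) * (ι F (b 4) * ι F (b 5)))))
        - (s * w 2) • (ι F (b 0) * (ι F (b 2) * (ι F (b 3) * (ι F (b 4) * ι F (b 6)))))
        + (s * w 3) • (ι F (b 0) * (ι F (b 2) * (ι F (b 3) * (ι F (b 5) * ι F (b 6)))))
        + w 4 • (ι F (b 0) * (ι F (b 2) * (ι F (b 4) * (ι F (b 5) * ι F (b 6)))))
        - w 5 • (ι F (b 0) * (ι F (b 3) * (ι F (b 4) * (ι F (b 5) * ι F (b 6)))))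
        + w 1 • (ι F (b 1) * (ι F (b 2) * (ι F (b 3) * (ι F (b 4) * ι F (b 5)))))
        + (s * w 3) • (ι F (b 1) * (ι F (b 2) * (ι F (b 3) * (ι F (b 4) * ι F (b 6)))))
        + (s * w 2) • (ι F (b 1) * (ι F (b 2) * (ι F (b 3) * (ι F (b 5) * ι F (b 6)))))
        - w 5 • (ι F (b 1) * (ι F (b 2) * (ι F (b 4) * (ι F (b 5) * ι F (b 6)))))
        - w 4 • (ι F (b 1) * (ι F (b 3) * (ι F (b 4) * (ι F (b 5) * ι F (b 6)))))
        + (s * w 6) • (ι F (b 2) * (ι F (b 3) * (ι F (b 4) * (ι F (b 5) * ι F (b 6)))))) := by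
  simp only [contractedForm, add_mul, sub_mul, mul_add, mul_sub, smul_mul_assoc, mul_smul_comm,
    mul_assoc]
  simp (discharger := decide) only [ι_mul_ι_of_lt, ι_mul_ι_mul_of_lt, ι_sq_zero,
    ι_mul_ι_mul_self, mul_neg, neg_neg, mul_zero, smul_zero, neg_zero, add_zero, zero_add,
    smul_neg, sub_zero, zero_sub, smul_sub, smul_add]
  match_scalars <;> first | ring1 | linear_combination (2 * w 6) * hs

theorem contractedForm_mul_contractedForm_mul {E : Type*} [AddCommGroup E] [Module F E]
    [CharZero F] {s : F} (hs : s = 1 ∨ s = -1) (b : Fin 7 → E) (v w : Fin 7 → F) :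
    (1 / 6 : F) • (contractedForm s b v * (contractedForm s b w *
      (s • (ι F (b 0) * (ι F (b 1) * ι F (b 6)))
      + s • (ι F (b 2) * (ι F (b 3) * ι F (b 6))) + ι F (b 4) * (ι F (b 5) * ι F (b 6))
      + ι F (b 0) * (ι F (b 2) * ι F (b 4)) - ι F (b 0) * (ι F (b 3) * ι F (b 5))
      - ι F (b 1) * (ι F (b 2) * ι F (b 5)) - ι F (b 1) * (ι F (b 3) * ι F (b 4))))) =
      (∑ i, metricSign s i * v i * w i) • (ι F (b 0) * (ι F (b 1) * (ι F (b 2) *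
      (ι F (b 3) * (ι F (b 4) * (ι F (b 5) * ι F (b 6))))))) := by
  have hs2 : s * s = 1 := by rcases hs with rfl | rfl <;> norm_num
  rw [contractedForm_mul hs2]
  simp only [Fin.sum_univ_seven, metricSign, Matrix.cons_val]
  simp only [contractedForm, add_mul, sub_mul, mul_add, mul_sub, smul_mul_assoc, mul_smul_comm,
    mul_assoc]
  simp (discharger := decide) only [ι_mul_ι_of_lt, ι_mul_ι_mul_of_lt, ι_sq_zero,
    ι_mul_ι_mul_self, mul_neg, mul_zero, smul_zero, neg_zero, add_zero, zero_add, sub_zero,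
    zero_sub]
  match_scalars
  rcases hs with rfl | rfl <;> ring

theorem contract_threeForm (s : F) (e : Basis (Fin 7) F V) (v : V) :
    contract v (threeForm s e) = contractedForm s e.coord (e.repr v) := by
  simp only [contract, threeForm, Submodule.coe_add, Submodule.coe_sub, Submodule.coe_smul,
    coe_ιMulti_three, map_add, map_sub, map_smul, contractLeft_ι_mul_ι_mul_ι, Dual.eval_apply]
  rfl

theorem metricFormula_threeForm [CharZero F] {s : F} (hs : s = 1 ∨ s = -1)
    (e : Basis (Fin 7) F V) : MetricFormula (threeForm s e) (metric s e) (e7 e) := by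
  intro v w
  rw [contract_threeForm, contract_threeForm, metric_apply, e7, coe_ιMulti_seven, mul_assoc]
  simp only [threeForm, Submodule.coe_add, Submodule.coe_sub, Submodule.coe_smul,
    coe_ιMulti_three]
  exact (contractedForm_mul_contractedForm_mul hs e.coord (e.repr v) (e.repr w)).symm

/-- Top forms are proportional, and pairing both sides with the frame `e'` gives the factor. -/
theorem ιMulti_coord_eq_det_smul {n : ℕ} (e e' : Basis (Fin n) F V) :
    exteriorPower.ιMulti F n e.coord = (e.toMatrix e').det • exteriorPower.ιMulti F n e'.coord := by
  have : FiniteDimensional F V := e.finiteDimensional_of_finite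
  have hn : finrank F V = n := by rw [finrank_eq_card_basis e, Fintype.card_fin]
  have h0 : exteriorPower.ιMulti F n e'.coord ≠ 0 := by
    rw [← e'.coe_dualBasis]
    exact ιMulti_basis_ne_zero e'.dualBasis
  obtain ⟨c, hc⟩ := exists_smul_eq hn h0 _ (exteriorPower.ιMulti F n e.coord).2
  have hc' : c • exteriorPower.ιMulti F n e'.coord = exteriorPower.ιMulti F n e.coord :=
    Subtype.ext hc
  have h1 := congrArg
    (fun x => exteriorPower.pairingDual F V n x (exteriorPower.ιMulti F n e')) hc'
  simp only [map_smul, LinearMap.smul_apply, exteriorPower.pairingDual_ιMulti_ιMulti] at h1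
  have h2 : (Matrix.of fun i j => e'.coord j (e' i)) = (1 : Matrix (Fin n) (Fin n) F) := by
    ext i j
    simp [Matrix.one_apply, Finsupp.single_apply]
  have h3 : (Matrix.of fun i j => e.coord j (e' i)) = (e.toMatrix e').transpose := by
    ext i j
    rfl
  rw [h2, h3, Matrix.det_one, Matrix.det_transpose, smul_eq_mul, mul_one] at h1
  rw [← hc', h1]

/-- If the volume forms differ by a factor `d`, the metric formula makes the metrics differ by `d`
too. Comparing Gram determinants gives `d ^ 7 * d ^ 2 = 1`, hence `d = 1` over `ℝ`. Allowing `s ≠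
s'` avoids having to separate the two types of structure. -/
theorem metric_eq_of_threeForm_eq {V : Type*} [AddCommGroup V] [Module ℝ V] {s s' : ℝ}
    (hs : s = 1 ∨ s = -1) (hs' : s' = 1 ∨ s' = -1) {e e' : Basis (Fin 7) ℝ V}
    (h : threeForm s e = threeForm s' e') : e7 e = e7 e' ∧ metric s e = metric s' e' := by
  have : FiniteDimensional ℝ V := e.finiteDimensional_of_finite
  have hn : finrank ℝ V = 7 := by rw [finrank_eq_card_basis e, Fintype.card_fin]
  have h7 : e7 e = (e.toMatrix e').det • e7 e' := ιMulti_coord_eq_det_smul e e'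
  have h0 : e7 e' ≠ 0 := by
    rw [e7, ← e'.coe_dualBasis]
    exact ιMulti_basis_ne_zero e'.dualBasis
  have hm : (e.toMatrix e').det • metric s e = metric s' e' := by
    refine (existsUnique_metricFormula hn h0 (threeForm s' e')).unique (fun v w => ?_)
      (metricFormula_threeForm hs' e')
    rw [← h, ← metricFormula_threeForm hs e v w, h7, Submodule.coe_smul, smul_smul,
      LinearMap.smul_apply, LinearMap.smul_apply, smul_eq_mul, mul_comm]
  have hd := congrArg (fun B => (LinearMap.BilinForm.toMatrix e' B).det) hm
  simp only [map_smul] at hd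
  rw [metric, metric, LinearMap.BilinForm.toMatrix_toBilin, det_metricSign hs', Matrix.det_smul,
    ← LinearMap.BilinForm.toMatrix_mul_basis_toMatrix e e', LinearMap.BilinForm.toMatrix_toBilin,
    Matrix.det_mul, Matrix.det_mul, Matrix.det_transpose, det_metricSign hs, Fintype.card_fin] at hd
  have h9 : (e.toMatrix e').det ^ 9 = 1 ^ 9 := by rw [one_pow, ← hd]; ring
  have h1 : (e.toMatrix e').det = 1 := (Odd.strictMono_pow (by decide)).injective h9
  rw [h1, one_smul] at h7 hm
  exact ⟨h7, hm⟩

theorem IsAdapted.exists_sign {V : Type*} [AddCommGroup V] [Module ℝ V] {φ : Form ℝ V 3}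
    {e : Basis (Fin 7) ℝ V} (h : IsAdapted φ e) :
    ∃ s : ℝ, (s = 1 ∨ s = -1) ∧ φ = threeForm s e := by
  rcases h with h | h
  · exact ⟨1, Or.inl rfl, h.trans (g2Form_eq e)⟩
  · exact ⟨-1, Or.inr rfl, h.trans (g2StarForm_eq e)⟩

theorem inducedMetric_threeForm {V : Type*} [AddCommGroup V] [Module ℝ V] {s : ℝ}
    (hs : s = 1 ∨ s = -1) (e : Basis (Fin 7) ℝ V) :
    inducedMetric (threeForm s e) = (metric s e, e7 e) := by
  have : FiniteDimensional ℝ V := e.finiteDimensional_of_finite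
  have hn : finrank ℝ V = 7 := by rw [finrank_eq_card_basis e, Fintype.card_fin]
  have hex : ∃ p : LinearMap.BilinForm ℝ V × Form ℝ V 7,
      IsInducedMetric (threeForm s e) p.1 p.2 := by
    refine ⟨(metric s e, e7 e), metricFormula_threeForm hs e, fun e' he' i j hij => ?_,
      fun e' he' i => ?_, fun e' he' => ?_⟩ <;>
    obtain ⟨s', hs', h⟩ := he'.exists_sign <;>
    obtain ⟨h7, hm⟩ := metric_eq_of_threeForm_eq hs hs' h
    · simp only [hm, metric_basis, if_neg hij]
    · simp only [hm, metric_basis, if_pos]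
      exact mul_self_eq_one_iff.1 (metricSign_sq hs' i)
    · exact h7
  have h := hex.choose_spec
  rw [inducedMetric, dif_pos hex]
  have had : IsAdapted (threeForm s e) e := by
    rcases hs with rfl | rfl
    · exact Or.inl (g2Form_eq e).symm
    · exact Or.inr (g2StarForm_eq e).symm
  -- The basis `e` itself fixes the volume form of the chosen pair; the metric formula then fixes
  -- the metric.
  have hvol := h.oriented e had
  have h0 : e7 e ≠ 0 := by
    rw [e7, ← e.coe_dualBasis]
    exact ιMulti_basis_ne_zero e.dualBasis
  refine Prod.ext ?_ hvol
  refine (existsUnique_metricFormula hn h0 (threeForm s e)).unique ?_ (metricFormula_threeForm hs e)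
  rw [← hvol]
  exact h.formula

theorem inducedMetricC_threeForm {W : Type*} [AddCommGroup W] [Module ℂ W]
    (e : Basis (Fin 7) ℂ W) :
    inducedMetricC (threeForm 1 e) (e7 e) = metric 1 e := by
  have : FiniteDimensional ℂ W := e.finiteDimensional_of_finite
  have hn : finrank ℂ W = 7 := by rw [finrank_eq_card_basis e, Fintype.card_fin]
  have hf := metricFormula_threeForm (Or.inl (rfl : (1 : ℂ) = 1)) e
  have hex : ∃ g : LinearMap.BilinForm ℂ W, MetricFormula (threeForm 1 e) g (e7 e) := ⟨_, hf⟩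
  have h0 : e7 e ≠ 0 := by
    rw [e7, ← e.coe_dualBasis]
    exact ιMulti_basis_ne_zero e.dualBasis
  rw [inducedMetricC, dif_pos hex]
  exact (existsUnique_metricFormula hn h0 (threeForm 1 e)).unique hex.choose_spec hf

theorem coord_sharp_metric [FiniteDimensional F V] {s : F} (hs : s = 1 ∨ s = -1)
    (e : Basis (Fin 7) F V) (ξ : Dual F V) (i : Fin 7) :
    e.coord i (sharp (metric s e) ξ) = metricSign s i * ξ (e i) := by
  have h : metric s e (sharp (metric s e) ξ) (e i) = ξ (e i) := by
    rw [sharp, dif_pos (metric_nondegenerate hs e)]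
    exact LinearMap.BilinForm.apply_toDual_symm_apply ξ (e i)
  rw [metric_apply, Finset.sum_eq_single i (fun k _ hk => by simp [hk.symm]) (by simp),
    Basis.repr_self, Finsupp.single_eq_same, mul_one] at h
  rw [← h, ← mul_assoc, metricSign_sq hs, one_mul, Basis.coord_apply]

end Hodge

/-! ### The Hodge dual and the complex case -/

section HodgeDual

variable {F V : Type*} [Field F] [AddCommGroup V] [Module F V]

theorem det_fin_four (A : Matrix (Fin 4) (Fin 4) F) : A.det =
    A 0 0 * (A 1 1 * (A 2 2 * A 3 3 - A 2 3 * A 3 2) - A 1 2 * (A 2 1 * A 3 3 - A 2 3 * A 3 1)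
      + A 1 3 * (A 2 1 * A 3 2 - A 2 2 * A 3 1))
    - A 0 1 * (A 1 0 * (A 2 2 * A 3 3 - A 2 3 * A 3 2) - A 1 2 * (A 2 0 * A 3 3 - A 2 3 * A 3 0)
      + A 1 3 * (A 2 0 * A 3 2 - A 2 2 * A 3 0))
    + A 0 2 * (A 1 0 * (A 2 1 * A 3 3 - A 2 3 * A 3 1) - A 1 1 * (A 2 0 * A 3 3 - A 2 3 * A 3 0)
      + A 1 3 * (A 2 0 * A 3 1 - A 2 1 * A 3 0))
    - A 0 3 * (A 1 0 * (A 2 1 * A 3 2 - A 2 2 * A 3 1) - A 1 1 * (A 2 0 * A 3 2 - A 2 2 * A 3 0)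
      + A 1 2 * (A 2 0 * A 3 1 - A 2 1 * A 3 0)) := by
  rw [Matrix.det_succ_row_zero, Fin.sum_univ_four]
  simp only [Matrix.det_fin_three, Matrix.submatrix_apply]
  simp [Fin.succAbove, Fin.lt_def]
  ring

theorem formInner_metric_ιMulti [FiniteDimensional F V] {s : F} (hs : s = 1 ∨ s = -1)
    (e : Basis (Fin 7) F V) (i j k l : Fin 7) (c : Fin 4 → Dual F V) :
    formInner (metric s e) (exteriorPower.ιMulti F 4 ![e.coord i, e.coord j, e.coord k, e.coord l])
      (exteriorPower.ιMulti F 4 c) =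
      (metricSign s i * metricSign s j * metricSign s k * metricSign s l) *
      (Matrix.of fun m n => c m (![e i, e j, e k, e l] n)).det := by
  rw [formInner, exteriorPower.map_apply_ιMulti, exteriorPower.pairingDual_ιMulti_ιMulti,
    det_fin_four, det_fin_four]
  simp only [Matrix.of_apply, Matrix.cons_val, Function.comp_apply, coord_sharp_metric hs]
  ring

/-- Wedging with `b 0`, `b 1`, `b 2` kills their components in the other factors, leaving the
complementary minor. Permuting the basis gives the same for each monomial of the three-form. -/
theorem ι_mul_ι_mul_ι_mul_sum {E : Type*} [AddCommGroup E] [Module F E] (b : Fin 7 → E)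
    (c : Fin 4 → Fin 7 → F) :
    ι F (b 0) * (ι F (b 1) * (ι F (b 2) * (ι F (∑ i, c 0 i • b i) * (ι F (∑ i, c 1 i • b i) *
      (ι F (∑ i, c 2 i • b i) * ι F (∑ i, c 3 i • b i)))))) =
    (Matrix.of fun m n => c m (![3, 4, 5, 6] n)).det • (ι F (b 0) * (ι F (b 1) * (ι F (b 2) *
      (ι F (b 3) * (ι F (b 4) * (ι F (b 5) * ι F (b 6))))))) := by
  obtain ⟨z₁, h₁⟩ : ∃ z, ι F (b 0) * ι F (b 1) * ι F (b 2) * ι F (∑ i, c 0 i • b i) = z :=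
    ⟨_, rfl⟩
  obtain ⟨z₂, h₂⟩ : ∃ z, z₁ * ι F (∑ i, c 1 i • b i) = z := ⟨_, rfl⟩
  obtain ⟨z₃, h₃⟩ : ∃ z, z₂ * ι F (∑ i, c 2 i • b i) = z := ⟨_, rfl⟩
  rw [← mul_assoc, ← mul_assoc, ← mul_assoc, h₁, ← mul_assoc, h₂, ← mul_assoc, h₃]
  simp only [Fin.sum_univ_seven, map_add, map_smul, mul_add, mul_smul_comm, mul_assoc] at h₁
  simp (discharger := decide) only [ι_mul_ι_of_lt, ι_mul_ι_mul_of_lt, ι_sq_zero,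
    ι_mul_ι_mul_self, mul_neg, neg_neg, mul_zero, smul_zero, neg_zero, zero_add] at h₁
  rw [← h₁] at h₂
  simp only [Fin.sum_univ_seven, map_add, map_smul, add_mul, mul_add,
    smul_mul_assoc, mul_smul_comm, mul_assoc] at h₂
  simp (discharger := decide) only [ι_mul_ι_of_lt, ι_mul_ι_mul_of_lt, ι_sq_zero,
    ι_mul_ι_mul_self, mul_neg, neg_neg, mul_zero, smul_zero, neg_zero, add_zero, zero_add,
    smul_neg] at h₂
  rw [← h₂] at h₃
  simp only [Fin.sum_univ_seven, map_add, map_smul, add_mul, mul_add, neg_mul,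
    smul_mul_assoc, mul_smul_comm, mul_assoc] at h₃
  simp (discharger := decide) only [ι_mul_ι_of_lt, ι_mul_ι_mul_of_lt, ι_sq_zero,
    ι_mul_ι_mul_self, mul_neg, neg_neg, mul_zero, smul_zero, neg_zero, add_zero, zero_add,
    smul_neg, smul_add] at h₃
  rw [← h₃]
  simp only [Fin.sum_univ_seven, map_add, map_smul, add_mul, mul_add, neg_mul,
    smul_mul_assoc, mul_smul_comm, mul_assoc]
  simp (discharger := decide) only [ι_mul_ι_of_lt, ι_mul_ι_mul_of_lt, ι_sq_zero,
    ι_mul_ι_mul_self, mul_neg, neg_neg, mul_zero, smul_zero, neg_zero, add_zero, zero_add,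
    smul_neg, smul_add]
  match_scalars
  simp only [det_fin_four, Matrix.of_apply, Matrix.cons_val]
  ring

theorem ι_mul_ι_mul_ι_mul_sum_of_bijective {E : Type*} [AddCommGroup E] [Module F E]
    (b : Fin 7 → E) (c : Fin 4 → Fin 7 → F) (τ : Fin 7 → Fin 7) (hτ : Function.Bijective τ) :
    ι F (b (τ 0)) * (ι F (b (τ 1)) * (ι F (b (τ 2)) * (ι F (∑ i, c 0 i • b i) *
      (ι F (∑ i, c 1 i • b i) * (ι F (∑ i, c 2 i • b i) * ι F (∑ i, c 3 i • b i)))))) =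
    (Matrix.of fun m n => c m (τ (![3, 4, 5, 6] n))).det • (ι F (b (τ 0)) * (ι F (b (τ 1)) *
      (ι F (b (τ 2)) * (ι F (b (τ 3)) * (ι F (b (τ 4)) * (ι F (b (τ 5)) * ι F (b (τ 6)))))))) := by
  simp only [← hτ.sum_comp fun i => c _ i • b i]
  exact ι_mul_ι_mul_ι_mul_sum (fun i => b (τ i)) fun m i => c m (τ i)

theorem threeForm_mul {E : Type*} [AddCommGroup E] [Module F E] (s : F) (b : Fin 7 → E)
    (c : Fin 4 → Fin 7 → F) :
    (s • (ι F (b 0) * (ι F (b 1) * ι F (b 6)))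
      + s • (ι F (b 2) * (ι F (b 3) * ι F (b 6))) + ι F (b 4) * (ι F (b 5) * ι F (b 6))
      + ι F (b 0) * (ι F (b 2) * ι F (b 4)) - ι F (b 0) * (ι F (b 3) * ι F (b 5))
      - ι F (b 1) * (ι F (b 2) * ι F (b 5)) - ι F (b 1) * (ι F (b 3) * ι F (b 4))) *
      (ι F (∑ i, c 0 i • b i) * (ι F (∑ i, c 1 i • b i) * (ι F (∑ i, c 2 i • b i) *
        ι F (∑ i, c 3 i • b i)))) =
    (s * (Matrix.of fun m n => c m (![2, 3, 4, 5] n)).det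
      + s * (Matrix.of fun m n => c m (![0, 1, 4, 5] n)).det
      + (Matrix.of fun m n => c m (![0, 1, 2, 3] n)).det
      - (Matrix.of fun m n => c m (![1, 3, 5, 6] n)).det
      + (Matrix.of fun m n => c m (![1, 2, 4, 6] n)).det
      + (Matrix.of fun m n => c m (![0, 3, 4, 6] n)).det
      + (Matrix.of fun m n => c m (![0, 2, 5, 6] n)).det) • (ι F (b 0) * (ι F (b 1) * (ι F (b 2) *
      (ι F (b 3) * (ι F (b 4) * (ι F (b 5) * ι F (b 6))))))) := by
  have h₁ := ι_mul_ι_mul_ι_mul_sum_of_bijective b c ![0, 1, 6, 2, 3, 4, 5] (by decide)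
  have h₂ := ι_mul_ι_mul_ι_mul_sum_of_bijective b c ![2, 3, 6, 0, 1, 4, 5] (by decide)
  have h₃ := ι_mul_ι_mul_ι_mul_sum_of_bijective b c ![4, 5, 6, 0, 1, 2, 3] (by decide)
  have h₄ := ι_mul_ι_mul_ι_mul_sum_of_bijective b c ![0, 2, 4, 1, 3, 5, 6] (by decide)
  have h₅ := ι_mul_ι_mul_ι_mul_sum_of_bijective b c ![0, 3, 5, 1, 2, 4, 6] (by decide)
  have h₆ := ι_mul_ι_mul_ι_mul_sum_of_bijective b c ![1, 2, 5, 0, 3, 4, 6] (by decide)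
  have h₇ := ι_mul_ι_mul_ι_mul_sum_of_bijective b c ![1, 3, 4, 0, 2, 5, 6] (by decide)
  simp only [Matrix.cons_val] at h₁ h₂ h₃ h₄ h₅ h₆ h₇
  simp only [add_mul, sub_mul, smul_mul_assoc, mul_assoc, h₁, h₂, h₃, h₄, h₅, h₆, h₇]
  simp (discharger := decide) only [ι_mul_ι_of_lt, ι_mul_ι_mul_of_lt, mul_neg, neg_neg]
  match_scalars
  simp only [det_fin_four, Matrix.of_apply, Matrix.cons_val]
  ring

theorem formInner_add_left [FiniteDimensional F V] (g : LinearMap.BilinForm F V) {k : ℕ}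
    (ψ ψ' χ : Form F V k) : formInner g (ψ + ψ') χ = formInner g ψ χ + formInner g ψ' χ := by
  rw [formInner, map_add, LinearMap.add_apply]; rfl

theorem formInner_sub_left [FiniteDimensional F V] (g : LinearMap.BilinForm F V) {k : ℕ}
    (ψ ψ' χ : Form F V k) : formInner g (ψ - ψ') χ = formInner g ψ χ - formInner g ψ' χ := by
  rw [formInner, map_sub, LinearMap.sub_apply]; rfl

theorem formInner_smul_left [FiniteDimensional F V] (g : LinearMap.BilinForm F V) {k : ℕ}
    (a : F) (ψ χ : Form F V k) : formInner g (a • ψ) χ = a * formInner g ψ χ := by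
  rw [formInner, map_smul, LinearMap.smul_apply]; rfl

theorem isHodgeDual_fourForm [FiniteDimensional F V] {s : F} (hs : s = 1 ∨ s = -1)
    (e : Basis (Fin 7) F V) :
    IsHodgeDual (metric s e) (e7 e) (threeForm s e) (fourForm s e.coord) := by
  intro χ
  have hχ : χ ∈ Submodule.span F (Set.range (exteriorPower.ιMulti F 4 (M := Dual F V))) := by
    rw [exteriorPower.ιMulti_span]; trivial
  induction hχ using Submodule.span_induction with
  | zero => simp [formInner]
  | add x y _ _ hx hy =>
    rw [Submodule.coe_add, mul_add, hx, hy, ← add_smul, formInner, formInner, formInner, map_add,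
      map_add]
  | smul a x _ hx =>
    rw [Submodule.coe_smul, mul_smul_comm, hx, smul_smul, formInner, formInner, map_smul, map_smul,
      smul_eq_mul]
  | mem x hx =>
    obtain ⟨c, rfl⟩ := hx
    have hc : c = ![∑ i, c 0 (e i) • e.coord i, ∑ i, c 1 (e i) • e.coord i,
        ∑ i, c 2 (e i) • e.coord i, ∑ i, c 3 (e i) • e.coord i] := by
      ext1 i
      fin_cases i <;> exact (e.sum_dual_apply_smul_coord _).symm
    obtain ⟨r, hr⟩ : ∃ r, formInner (metric s e) (fourForm s e.coord)
      (exteriorPower.ιMulti F 4 c) = r := ⟨_, rfl⟩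
    rw [hr, hc, coe_ιMulti_four]
    simp only [fourForm, formInner_add_left, formInner_sub_left, formInner_smul_left,
      formInner_metric_ιMulti hs] at hr
    rw [e7, coe_ιMulti_seven, ← hr]
    simp only [threeForm, Submodule.coe_add, Submodule.coe_sub, Submodule.coe_smul,
      coe_ιMulti_three]
    refine (threeForm_mul s e.coord fun m i => c m (e i)).trans ?_
    congr 1
    -- Each monomial of the four-form has two or four indices among `0, …, 3`, so its metric signs
    -- multiply to 1.
    simp only [det_fin_four, Matrix.of_apply, Matrix.cons_val, metricSign]
    rcases hs with rfl | rfl <;> ring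

theorem hodgeStar_threeForm [FiniteDimensional F V] {s : F} (hs : s = 1 ∨ s = -1)
    (e : Basis (Fin 7) F V) :
    hodgeStar (metric s e) (e7 e) (threeForm s e) = fourForm s e.coord := by
  have hn : finrank F V = 7 := by rw [finrank_eq_card_basis e, Fintype.card_fin]
  have h0 : e7 e ≠ 0 := by
    rw [e7, ← e.coe_dualBasis]
    exact ιMulti_basis_ne_zero e.dualBasis
  have h := isHodgeDual_fourForm hs e
  have hex : ∃ Ψ : Form F V 4, IsHodgeDual (metric s e) (e7 e) (threeForm s e) Ψ := ⟨_, h⟩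
  rw [hodgeStar, dif_pos hex]
  exact (existsUnique_isHodgeDual (metric_nondegenerate hs e) hn rfl h0 _).unique
    hex.choose_spec h

/-- Over `ℂ` the four-forms of both types agree up to a rescaling of the basis. -/
theorem fourForm_one_eq {E : Type*} [AddCommGroup E] [Module ℂ E] (b : Basis (Fin 7) ℂ E) :
    ∃ b' : Basis (Fin 7) ℂ E, fourForm (1 : ℂ) b = fourForm (-1 : ℂ) b' := by
  let I' : ℂˣ := Units.mk0 Complex.I Complex.I_ne_zero
  -- The scalars give factor 1 on the monomial `0123`, `-1` on the two monomials carrying `s`, and 1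
  -- on those with index 6.
  refine ⟨b.unitsSMul ![I', I', I', I', -1, -1, 1], Subtype.ext ?_⟩
  simp only [fourForm, Submodule.coe_add, Submodule.coe_sub, Submodule.coe_smul, coe_ιMulti_four,
    Basis.unitsSMul_apply, Matrix.cons_val, Units.smul_def, I', Units.val_mk0, Units.val_neg,
    Units.val_one, map_smul, smul_mul_assoc, mul_smul_comm]
  match_scalars <;> first
    | linear_combination Complex.I_sq
    | linear_combination -Complex.I_sq
    | linear_combination (1 - Complex.I ^ 2) * Complex.I_sq

end HodgeDual

end G2Inv

theorem mainTheorem11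
    {V : Type*} [AddCommGroup V] [Module ℝ V] [FiniteDimensional ℝ V]
    (hV : Module.finrank ℝ V = 7)
    {W : Type*} [AddCommGroup W] [Module ℂ W] [FiniteDimensional ℂ W]
    (hW : Module.finrank ℂ W = 7) :
    (∀ φ : G2Inv.Form ℝ V 3, G2Inv.IsG2Structure φ →
      (G2Inv.rank (G2Inv.hodgeDual φ), G2Inv.length (G2Inv.hodgeDual φ),
        G2Inv.invM (G2Inv.hodgeDual φ), G2Inv.invR (G2Inv.hodgeDual φ)) = (7, 5, 3, 3)) ∧
    (∀ φ : G2Inv.Form ℝ V 3, G2Inv.IsG2StarStructure φ →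
      (G2Inv.rank (G2Inv.hodgeDual φ), G2Inv.length (G2Inv.hodgeDual φ),
        G2Inv.invM (G2Inv.hodgeDual φ), G2Inv.invR (G2Inv.hodgeDual φ)) = (7, 4, 2, 2)) ∧
    (∀ (φ : G2Inv.Form ℂ W 3) (vol : G2Inv.Form ℂ W 7), G2Inv.IsG2CStructure φ vol →
      (G2Inv.rank (G2Inv.hodgeDualC φ vol), G2Inv.length (G2Inv.hodgeDualC φ vol),
        G2Inv.invM (G2Inv.hodgeDualC φ vol), G2Inv.invR (G2Inv.hodgeDualC φ vol)) =
          (7, 4, 2, 2)) := by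
  refine ⟨?_, ?_, ?_⟩
  · rintro _ ⟨e, rfl⟩
    rw [G2Inv.g2Form_eq, G2Inv.hodgeDual, G2Inv.inducedMetric_threeForm (Or.inl rfl),
      G2Inv.hodgeStar_threeForm (Or.inl rfl), ← e.coe_dualBasis]
    exact G2Inv.invariants_fourForm_one e.dualBasis
  · rintro _ ⟨e, rfl⟩
    rw [G2Inv.g2StarForm_eq, G2Inv.hodgeDual, G2Inv.inducedMetric_threeForm (Or.inr rfl),
      G2Inv.hodgeStar_threeForm (Or.inr rfl), ← e.coe_dualBasis]
    exact G2Inv.invariants_fourForm_neg_one e.dualBasis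
  · rintro _ _ ⟨e, rfl, rfl⟩
    obtain ⟨b, hb⟩ := G2Inv.fourForm_one_eq e.dualBasis
    rw [G2Inv.g2Form_eq, G2Inv.hodgeDualC, G2Inv.inducedMetricC_threeForm,
      G2Inv.hodgeStar_threeForm (Or.inl rfl), ← e.coe_dualBasis, hb]
    exact G2Inv.invariants_fourForm_neg_one b
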